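/- Let $k$ be a field with the discrete topology, and let $A$ be a pseudocompact $k$-algebra: an associative unital topological $k$-algebra that is complete and Hausdorff and in which the open two-sided ideals of finite codimension form a basis of neighbourhoods of $0$. A pseudocompact $A$-module is an inverse limit of discrete finite-dimensional topological left $A$-modules (equivalently, a complete Hausdorff topological left $A$-module in which the open submodules of finite $k$-codimension form a basis of neighbourhoods of $0$); it is simple if it is nonzero and its only closed submodules are $0$ and itself. Morphisms are continuous homomorphisms, isomorphisms are topological, and products carry the product topology. A pseudocompact module $P$ is projective if every continuous homomorphism $P\to N$ lifts along every surjective continuous homomorphism $M\to N$ of pseudocompact modules, and $Q$ is injective if every continuous homomorphism $M\to Q$ extends along every injective continuous homomorphism $M\to N$ of pseudocompact modules. Let $J(A)$ be the intersection of the maximal closed left ideals of $A$ (the maximal elements among the proper closed left ideals). The following conditions are equivalent. 1. $A$ is (left) topologically semisimple: for every closed left ideal $I$ of $A$ there is a closed left ideal $L$ with $A=I\oplus L$. 2. $J(A)=0$. 3. The left $A$-module $A$ is isomorphic to a product of simple pseudocompact $A$-modules. 4. Every pseudocompact left $A$-module is projective. 5. Every pseudocompact left $A$-module is injective. 6. $A$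 is isomorphic, as a topological algebra, to the inverse limit of an inverse system, indexed by a directed set, of discrete finite-dimensional semisimple $k$-algebras. 7. $A$ is isomorphic, as a topological algebra, to a (possibly infinite) product $\prod_{i\in X} M_{n_i}(D_i)$, where the $n_i$ are positive integers and the $D_i$ are finite-dimensional discrete division $k$-algebras. Moreover, the decomposition in 7 is unique up to permutation of the factors and isomorphism of the division algebras: if $A\cong\prod_{i\in X} M_{n_i}(D_i)$ and $A\cong\prod_{j\in Y} M_{m_j}(E_j)$ are two such isomorphisms, then there is a bijection $\sigma\colon X\to Y$ with $n_i=m_{\sigma(i)}$ and $D_i\cong E_{\sigma(i)}$ as $k$-algebras for all $i\in X$. -/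

import Mathlib

open Topology

universe u v w w₁ w₂

namespace Pseudocompact

/-- A pseudocompact algebra over a field `k` (with `k` discrete): a Hausdorff topological algebra
whose two-sided ideals of finite codimension that are open form a basis of neighbourhoods of `0`,
and which is complete. Since `k` is discrete, continuity of the scalar multiplication `k × A → A`
follows from that of the multiplication of `A`. -/
class IsPseudocompactAlgebra (k : Type u) (A : Type v) [Field k] [Ring A] [Algebra k A]
    [TopologicalSpace A] : Prop extends IsTopologicalRing A, T2Space A where
  exists_ideal : ∀ s ∈ 𝓝 (0 : A), ∃ I : Ideal A, I.IsTwoSided ∧ IsOpen (I : Set A) ∧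
    FiniteDimensional k (A ⧸ I) ∧ (I : Set A) ⊆ s
  complete : @CompleteSpace A (IsTopologicalAddGroup.rightUniformSpace A)

/-- A pseudocompact left `A`-module: a Hausdorff topological `A`-module whose open submodules of
finite codimension over `k` form a basis of neighbourhoods of `0`, and which is complete; that is,
an inverse limit of discrete finite-dimensional topological `A`-modules. -/
class IsPseudocompactModule (k : Type u) (A : Type v) (U : Type w) [Field k] [Ring A] [Algebra k A]
    [TopologicalSpace A] [AddCommGroup U] [Module k U] [Module A U] [IsScalarTower k A U]
    [TopologicalSpace U] : Prop extends IsTopologicalAddGroup U, ContinuousSMul A U, T2Space U where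
  exists_submodule : ∀ s ∈ 𝓝 (0 : U), ∃ V : Submodule A U, IsOpen (V : Set U) ∧
    FiniteDimensional k (U ⧸ V) ∧ (V : Set U) ⊆ s
  complete : @CompleteSpace U (IsTopologicalAddGroup.rightUniformSpace U)

/-- A simple pseudocompact module: a nonzero pseudocompact module whose only closed submodules are
`0` and itself. -/
class IsSimplePseudocompactModule (k : Type u) (A : Type v) (U : Type w) [Field k] [Ring A]
    [Algebra k A] [TopologicalSpace A] [AddCommGroup U] [Module k U] [Module A U]
    [IsScalarTower k A U] [TopologicalSpace U] : Prop
    extends IsPseudocompactModule k A U, Nontrivial U where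
  eq_bot_or_eq_top : ∀ N : Submodule A U, IsClosed (N : Set U) → N = ⊥ ∨ N = ⊤

/-- `P` is projective with respect to pseudocompact `A`-modules (in its own universe): continuous
homomorphisms out of `P` lift along surjective continuous homomorphisms. -/
def IsProjective (k : Type u) (A : Type v) [Field k] [Ring A] [Algebra k A] [TopologicalSpace A]
    (P : Type w) [AddCommGroup P] [Module A P] [TopologicalSpace P] : Prop :=
  ∀ (M N : Type w)
    [AddCommGroup M] [Module k M] [Module A M] [IsScalarTower k A M] [TopologicalSpace M]
    [AddCommGroup N] [Module k N] [Module A N] [IsScalarTower k A N] [TopologicalSpace N]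
    [IsPseudocompactModule k A M] [IsPseudocompactModule k A N]
    (f : M →L[A] N) (g : P →L[A] N), Function.Surjective f → ∃ h : P →L[A] M, f.comp h = g

/-- `Q` is injective with respect to pseudocompact `A`-modules (in its own universe): continuous
homomorphisms into `Q` extend along injective continuous homomorphisms. -/
def IsInjective (k : Type u) (A : Type v) [Field k] [Ring A] [Algebra k A] [TopologicalSpace A]
    (Q : Type w) [AddCommGroup Q] [Module A Q] [TopologicalSpace Q] : Prop :=
  ∀ (M N : Type w)
    [AddCommGroup M] [Module k M] [Module A M] [IsScalarTower k A M] [TopologicalSpace M]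
    [AddCommGroup N] [Module k N] [Module A N] [IsScalarTower k A N] [TopologicalSpace N]
    [IsPseudocompactModule k A M] [IsPseudocompactModule k A N]
    (f : M →L[A] N) (g : M →L[A] Q), Function.Injective f → ∃ h : N →L[A] Q, h.comp f = g

/-- Every pseudocompact left `A`-module is projective in the category of pseudocompact modules. -/
def EveryModuleProjective (k : Type u) (A : Type v) [Field k] [Ring A] [Algebra k A]
    [TopologicalSpace A] : Prop :=
  ∀ (U : Type v) [AddCommGroup U] [Module k U] [Module A U] [IsScalarTower k A U]
    [TopologicalSpace U] [IsPseudocompactModule k A U], IsProjective k A U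

/-- Every pseudocompact left `A`-module is injective in the category of pseudocompact modules. -/
def EveryModuleInjective (k : Type u) (A : Type v) [Field k] [Ring A] [Algebra k A]
    [TopologicalSpace A] : Prop :=
  ∀ (U : Type v) [AddCommGroup U] [Module k U] [Module A U] [IsScalarTower k A U]
    [TopologicalSpace U] [IsPseudocompactModule k A U], IsInjective k A U

/-- `A` is (left) topologically semisimple: every closed left ideal has a closed complement. -/
def IsTopologicallySemisimple (A : Type v) [Ring A] [TopologicalSpace A] : Prop :=
  ∀ I : Ideal A, IsClosed (I : Set A) → ∃ L : Ideal A, IsClosed (L : Set A) ∧ IsCompl I L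

/-- A maximal closed left ideal: maximal among the proper closed left ideals. -/
def IsMaximalClosed {A : Type v} [Ring A] [TopologicalSpace A] (I : Ideal A) : Prop :=
  Maximal (fun L : Ideal A => IsClosed (L : Set A) ∧ L ≠ ⊤) I

/-- The topological Jacobson radical: the intersection of the maximal closed left ideals. -/
def topJacobson (A : Type v) [Ring A] [TopologicalSpace A] : Ideal A :=
  sInf {I : Ideal A | IsMaximalClosed I}

/-- The left module `A` is isomorphic, as a topological module, to a product of simple pseudocompact
modules with the product topology. -/
def IsProductOfSimples (k : Type u) (A : Type v) [Field k] [Ring A] [Algebra k A]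
    [TopologicalSpace A] : Prop :=
  ∃ (ι : Type v) (S : ι → Type v) (_ : ∀ i, AddCommGroup (S i)) (_ : ∀ i, Module k (S i))
    (_ : ∀ i, Module A (S i)) (_ : ∀ i, IsScalarTower k A (S i)) (_ : ∀ i, TopologicalSpace (S i)),
    (∀ i, IsSimplePseudocompactModule k A (S i)) ∧ Nonempty (A ≃L[A] (∀ i, S i))

/-- An inverse system of discrete finite-dimensional `k`-algebras over a directed set. -/
structure FinDimInverseSystem (k : Type u) [Field k] where
  ι : Type v
  B : ι → Type v
  [preorder : Preorder ι]
  [directed : IsDirectedOrder ι]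
  [nonempty : Nonempty ι]
  [ring : ∀ i, Ring (B i)]
  [algebra : ∀ i, Algebra k (B i)]
  [finiteDimensional : ∀ i, FiniteDimensional k (B i)]
  [topology : ∀ i, TopologicalSpace (B i)]
  [discrete : ∀ i, DiscreteTopology (B i)]
  /-- the transition homomorphisms -/
  φ : ∀ ⦃i j⦄, i ≤ j → B j →ₐ[k] B i
  φ_self : ∀ i, φ (le_refl i) = AlgHom.id k (B i)
  φ_comp : ∀ ⦃i j l⦄ (hij : i ≤ j) (hjl : j ≤ l), (φ hij).comp (φ hjl) = φ (hij.trans hjl)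

attribute [instance] FinDimInverseSystem.preorder FinDimInverseSystem.directed
  FinDimInverseSystem.nonempty FinDimInverseSystem.ring FinDimInverseSystem.algebra
  FinDimInverseSystem.finiteDimensional FinDimInverseSystem.topology FinDimInverseSystem.discrete

/-- The inverse limit: the algebra of compatible families, a subspace of the product. -/
def FinDimInverseSystem.limit {k : Type u} [Field k] (X : FinDimInverseSystem.{u, v} k) :
    Subalgebra k (∀ i, X.B i) where
  carrier := {x | ∀ ⦃i j⦄ (h : i ≤ j), X.φ h (x j) = x i}
  mul_mem' hx hy i j h := by simp [hx h, hy h]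
  add_mem' hx hy i j h := by simp [hx h, hy h]
  algebraMap_mem' c i j h := by simp

/-- `A` is, as a topological algebra, an inverse limit of discrete finite-dimensional semisimple
algebras. -/
def IsInverseLimitOfSemisimple (k : Type u) (A : Type v) [Field k] [Ring A] [Algebra k A]
    [TopologicalSpace A] : Prop :=
  ∃ X : FinDimInverseSystem.{u, v} k, (∀ i, IsSemisimpleRing (X.B i)) ∧ Nonempty (A ≃A[k] X.limit)

/-- A family of positive integers `n i` and discrete finite-dimensional division `k`-algebras
`D i`. -/
structure DivisionFamily (k : Type u) [Field k] where
  ι : Type v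
  n : ι → ℕ
  n_pos : ∀ i, 0 < n i
  D : ι → Type v
  [divisionRing : ∀ i, DivisionRing (D i)]
  [algebra : ∀ i, Algebra k (D i)]
  [finiteDimensional : ∀ i, FiniteDimensional k (D i)]
  [topology : ∀ i, TopologicalSpace (D i)]
  [discrete : ∀ i, DiscreteTopology (D i)]

attribute [instance] DivisionFamily.divisionRing DivisionFamily.algebra
  DivisionFamily.finiteDimensional DivisionFamily.topology DivisionFamily.discrete

/-- The product of the full matrix algebras `M_{n i}(D i)`, with the product topology. -/
abbrev DivisionFamily.MatrixProduct {k : Type u} [Field k] (F : DivisionFamily.{u, v} k) : Type v :=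
  ∀ i, Matrix (Fin (F.n i)) (Fin (F.n i)) (F.D i)

end Pseudocompact

/-! The engine is linear compactness: in a pseudocompact module, a family of cosets of closed
submodules has a common point as soon as every finite subfamily does. It replaces Tychonoff's
theorem. The role of finiteness is played by the descending chain condition on the
finite-dimensional quotients by open submodules: a family of cosets that is maximal for finite
intersections is a Cauchy filter base, and completeness supplies a limit. Consequently images of
closed submodules are closed, closed submodules of finite codimension are open, and an intersection
of closed submodules lying in an open one lies there at a finite stage.

The equivalence turns on one intermediate condition, `HasSemisimpleQuotients`. Under it every closed
submodule of every pseudocompact module has a closed complement (Zorn, with linear compactness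
bounding the chains), so surjections and injections split continuously; this gives 1, 4 and 5.
Conversely, 4 and 5 applied to the discrete modules around `A ⧸ I` make these semisimple. The
radical enters through finiteness: if it vanishes, finitely many maximal closed left ideals already
intersect inside a given open `V`, so `A ⧸ V` is a quotient of a submodule of a finite product of
simple modules.

For 6, `A` is the limit of its quotients by open two-sided ideals. Conversely, stable images in an
inverse system are semisimple quotients of `A`. For 7, the open two-sided ideals with simple
quotient intersect in zero and are pairwise coprime; the Chinese remainder theorem with linear
compactness makes `A` the product of these quotients, and Wedderburn's theorem identifies them.
Splitting matrices into columns gives 3, and the coordinate kernels in 3 force the radical to be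
zero.

Uniqueness is purely algebraic: the factors are cut out by central idempotents that any isomorphism
permutes, and a matrix algebra determines its division algebra through the endomorphisms of its
simple module. -/

namespace Pseudocompact

/-! ### Maximal families of cosets with finite intersections -/

section LinearCompactness

variable {A : Type v} {U : Type w} [Ring A] [AddCommGroup U] [Module A U]

/-- A family of affine subspaces has the finite intersection property. -/
def HasFiniteIntersections (S : Set (AffineSubspace A U)) : Prop :=
  ∀ t ⊆ S, t.Finite → (⋂ s ∈ t, (s : Set U)).Nonempty

theorem isOfFiniteCharacter_hasFiniteIntersections :
    Order.IsOfFiniteCharacter {S : Set (AffineSubspace A U) | HasFiniteIntersections S} :=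
  fun _ ↦ ⟨fun hS _ ht _ _ hr hf ↦ hS _ (hr.trans ht) hf,
    fun h t ht hf ↦ h t ht hf t subset_rfl hf⟩

variable {S : Set (AffineSubspace A U)}

theorem HasFiniteIntersections.mem_of_maximal (hS : Maximal HasFiniteIntersections S)
    {c : AffineSubspace A U}
    (hc : ∀ t ⊆ S, t.Finite → ((⋂ s ∈ t, (s : Set U)) ∩ c).Nonempty) : c ∈ S := by
  have key : HasFiniteIntersections (insert c S) := by
    intro t ht hf
    obtain ⟨y, hy, hyc⟩ := hc (t \ {c}) (fun x hx ↦ (ht hx.1).resolve_left hx.2)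
      (hf.subset Set.sdiff_subset)
    refine ⟨y, Set.mem_iInter₂.2 fun s hs ↦ ?_⟩
    by_cases h : s = c
    · exact h ▸ hyc
    · exact Set.mem_iInter₂.1 hy s ⟨hs, h⟩
  exact hS.2 key (Set.subset_insert _ _) (Set.mem_insert _ _)

theorem HasFiniteIntersections.inf_mem_of_maximal (hS : Maximal HasFiniteIntersections S)
    {s₁ s₂ : AffineSubspace A U} (h₁ : s₁ ∈ S) (h₂ : s₂ ∈ S) : s₁ ⊓ s₂ ∈ S := by
  refine mem_of_maximal hS fun t ht hf ↦ ?_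
  obtain ⟨y, hy⟩ := hS.1 (insert s₁ (insert s₂ t))
    (Set.insert_subset h₁ (Set.insert_subset h₂ ht)) ((hf.insert _).insert _)
  simp only [Set.mem_insert_iff, Set.iInter_iInter_eq_or_left, Set.mem_inter_iff] at hy
  exact ⟨y, hy.2.2, hy.1, hy.2.1⟩

theorem HasFiniteIntersections.exists_mem_subset_of_maximal
    (hS : Maximal HasFiniteIntersections S) {t : Set (AffineSubspace A U)} (ht : t ⊆ S)
    (hf : t.Finite) : ∃ m ∈ S, (m : Set U) ⊆ ⋂ s ∈ t, (s : Set U) := by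
  induction t, hf using Set.Finite.induction_on with
  | empty =>
    refine ⟨⊤, mem_of_maximal hS fun t ht hf ↦ ?_, by simp⟩
    simpa using hS.1 t ht hf
  | @insert a s _ _ ih =>
    obtain ⟨m, hm, hms⟩ := ih fun x hx ↦ ht (Set.mem_insert_of_mem _ hx)
    refine ⟨a ⊓ m, inf_mem_of_maximal hS (ht (Set.mem_insert _ _)) hm, ?_⟩
    rw [Set.biInter_insert]
    exact Set.inter_subset_inter subset_rfl hms

theorem HasFiniteIntersections.mem_of_maximal_of_forall_inter
    (hS : Maximal HasFiniteIntersections S) {c : AffineSubspace A U}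
    (hc : ∀ m ∈ S, ((m : Set U) ∩ c).Nonempty) : c ∈ S := by
  refine mem_of_maximal hS fun t ht hf ↦ ?_
  obtain ⟨m, hm, hmt⟩ := exists_mem_subset_of_maximal hS ht hf
  exact (hc m hm).mono (Set.inter_subset_inter hmt subset_rfl)

theorem HasFiniteIntersections.nonempty_of_mem (hS : HasFiniteIntersections S)
    {s : AffineSubspace A U} (hs : s ∈ S) : (s : Set U).Nonempty := by
  simpa using hS {s} (by simpa using hs) (Set.finite_singleton s)

/-- This is what makes a maximal family Cauchy. Take a member `m₀` whose direction has minimal image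
in the artinian module `U ⧸ V`. For any member `m`, the direction of `m₀ ⊓ m` has the same image, so
a point of `m₀ ⊓ m` can be moved inside it into `x + V`. Hence `x + V` meets every member, and
maximality puts it in the family. -/
theorem HasFiniteIntersections.exists_mk'_mem_of_maximal
    (hS : Maximal HasFiniteIntersections S) (V : Submodule A U) [IsArtinian A (U ⧸ V)] :
    ∃ x, AffineSubspace.mk' x V ∈ S := by
  obtain ⟨_, ⟨m₀, hm₀, rfl⟩, hmin⟩ := IsWellFounded.wf (r := (· < · : Submodule A (U ⧸ V) → _))
    |>.has_min ((fun m : AffineSubspace A U ↦ m.direction.map V.mkQ) '' S)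
    ((exists_mem_subset_of_maximal hS (Set.empty_subset _) Set.finite_empty).imp
      (fun m hm ↦ hm.1) |>.elim fun m hm ↦ ⟨_, m, hm, rfl⟩)
  obtain ⟨x, hx⟩ := nonempty_of_mem hS.1 hm₀
  refine ⟨x, mem_of_maximal_of_forall_inter hS fun m hm ↦ ?_⟩
  have hmem := inf_mem_of_maximal hS hm₀ hm
  obtain ⟨y, hy₀, hy⟩ := nonempty_of_mem hS.1 hmem
  have hle : (m₀ ⊓ m).direction ≤ m₀.direction := AffineSubspace.direction_le inf_le_left
  have heq : (m₀ ⊓ m).direction.map V.mkQ = m₀.direction.map V.mkQ :=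
    (Submodule.map_mono hle).eq_of_not_lt (hmin _ ⟨_, hmem, rfl⟩)
  have hd : V.mkQ (x -ᵥ y) ∈ m₀.direction.map V.mkQ :=
    Submodule.mem_map_of_mem (AffineSubspace.vsub_mem_direction hx hy₀)
  rw [← heq] at hd
  obtain ⟨d, hd, hdx⟩ := hd
  refine ⟨d +ᵥ y, ?_, ?_⟩
  · exact ((AffineSubspace.vadd_mem_iff_mem_direction d
      (show y ∈ m₀ ⊓ m from ⟨hy₀, hy⟩)).2 hd).2
  · refine AffineSubspace.mem_mk'.2 ?_
    have := (Submodule.Quotient.eq V).1 hdx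
    simpa [vsub_eq_sub, vadd_eq_add, sub_sub_eq_add_sub] using this

end LinearCompactness

/-! ### Linear compactness of pseudocompact modules -/

section Modules

variable {k : Type u} {A : Type v} {U : Type w} [Field k] [Ring A] [Algebra k A]
  [TopologicalSpace A] [AddCommGroup U] [Module k U] [Module A U] [IsScalarTower k A U]
  [TopologicalSpace U]

omit [TopologicalSpace A] in
theorem isArtinian_of_finiteDimensional {M : Type*} [AddCommGroup M] [Module k M] [Module A M]
    [IsScalarTower k A M] [FiniteDimensional k M] : IsArtinian A M :=
  isArtinian_of_tower k inferInstance

variable (k) [IsPseudocompactModule k A U]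

include k in
/-- Pseudocompact modules are linearly compact: a family of cosets of closed submodules with the
finite intersection property has a common point. -/
theorem exists_forall_sub_mem {ι : Type*} (c : ι → U) (N : ι → Submodule A U)
    (hN : ∀ i, IsClosed (N i : Set U)) (h : ∀ t : Finset ι, ∃ x, ∀ i ∈ t, x - c i ∈ N i) :
    ∃ x, ∀ i, x - c i ∈ N i := by
  classical
  have hta : IsTopologicalAddGroup U := IsPseudocompactModule.toIsTopologicalAddGroup k A
  have hfip : HasFiniteIntersections (Set.range fun i ↦ AffineSubspace.mk' (c i) (N i)) := by
    intro t ht hf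
    have hex : ∀ s : t, ∃ i, AffineSubspace.mk' (c i) (N i) = s := fun s ↦ ht s.2
    choose g hg using hex
    have := hf.fintype
    obtain ⟨x, hx⟩ := h (Finset.univ.image g)
    refine ⟨x, Set.mem_iInter₂.2 fun s hs ↦ ?_⟩
    have := hx (g ⟨s, hs⟩) (Finset.mem_image_of_mem g (Finset.mem_univ _))
    have hs' : AffineSubspace.mk' (c _) (N _) = s := hg ⟨s, hs⟩
    exact hs'.subst (motive := fun r : AffineSubspace A U ↦ x ∈ r) (AffineSubspace.mem_mk'.2 this)
  obtain ⟨S, hrS, hS⟩ := isOfFiniteCharacter_hasFiniteIntersections.exists_maximal hfip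
  -- The members of the maximal family generate a Cauchy filter; its limit lies in every closed
  -- coset of the family.
  let F : Filter U :=
    { sets := {X | ∃ m ∈ S, (m : Set U) ⊆ X}
      univ_sets := (HasFiniteIntersections.exists_mem_subset_of_maximal hS
        (Set.empty_subset _) Set.finite_empty).imp fun m hm ↦ ⟨hm.1, Set.subset_univ _⟩
      sets_of_superset := fun ⟨m, hm, hmx⟩ hxy ↦ ⟨m, hm, hmx.trans hxy⟩
      inter_sets := fun ⟨m, hm, hmx⟩ ⟨n, hn, hnx⟩ ↦
        ⟨m ⊓ n, HasFiniteIntersections.inf_mem_of_maximal hS hm hn,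
          Set.inter_subset_inter hmx hnx⟩ }
  have hmem : ∀ {X : Set U}, X ∈ F ↔ ∃ m ∈ S, (m : Set U) ⊆ X := Iff.rfl
  let _ := IsTopologicalAddGroup.rightUniformSpace U
  have hcomplete : CompleteSpace U := IsPseudocompactModule.complete (k := k) (A := A)
  have hne : F.NeBot := by
    refine ⟨fun hF ↦ ?_⟩
    obtain ⟨m, hm, hm'⟩ := hmem.1 (hF ▸ Filter.mem_bot : (∅ : Set U) ∈ F)
    obtain ⟨y, hy⟩ := HasFiniteIntersections.nonempty_of_mem hS.1 hm
    exact hm' hy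
  have hF : Cauchy F := by
    refine ⟨hne, ?_⟩
    rintro X ⟨s, hs, hsX⟩
    obtain ⟨V, hV, hVf, hVs⟩ := IsPseudocompactModule.exists_submodule (k := k) (A := A) s hs
    have := isArtinian_of_finiteDimensional (k := k) (A := A) (M := U ⧸ V)
    obtain ⟨x, hx⟩ := HasFiniteIntersections.exists_mk'_mem_of_maximal hS V
    have hxF : (AffineSubspace.mk' x V : Set U) ∈ F := hmem.2 ⟨_, hx, subset_rfl⟩
    refine Filter.mem_of_superset (Filter.prod_mem_prod hxF hxF) ?_
    rintro ⟨a, b⟩ ⟨ha, hb⟩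
    refine hsX (hVs ?_)
    have := V.sub_mem (AffineSubspace.mem_mk'.1 hb) (AffineSubspace.mem_mk'.1 ha)
    simpa [sub_eq_add_neg] using this
  obtain ⟨y, hy⟩ := CompleteSpace.complete hF
  refine ⟨y, fun i ↦ ?_⟩
  have hi : (AffineSubspace.mk' (c i) (N i) : Set U) ∈ F := hmem.2 ⟨_, hrS ⟨i, rfl⟩, subset_rfl⟩
  have hcl : IsClosed (AffineSubspace.mk' (c i) (N i) : Set U) :=
    (hN i).preimage (continuous_id.sub continuous_const : Continuous fun x : U ↦ x - c i)
  have := isClosed_iff_clusterPt.1 hcl y ?_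
  · exact AffineSubspace.mem_mk'.1 this
  · exact (ClusterPt.of_le_nhds hy).mono (Filter.le_principal_iff.2 hi)

end Modules

/-! ### Open and closed submodules -/

section Modules

variable (k : Type u) {A : Type v} {U : Type w} [Field k] [Ring A] [Algebra k A]
  [TopologicalSpace A] [AddCommGroup U] [Module k U] [Module A U] [IsScalarTower k A U]
  [TopologicalSpace U] [IsPseudocompactModule k A U]

include k

theorem finiteDimensional_quotient_of_isOpen (V : Submodule A U) (hV : IsOpen (V : Set U)) :
    FiniteDimensional k (U ⧸ V) := by
  obtain ⟨W, _, _, hW⟩ := IsPseudocompactModule.exists_submodule (k := k) (A := A) (V : Set U)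
    (hV.mem_nhds V.zero_mem)
  exact Module.Finite.of_surjective ((Submodule.factor hW).restrictScalars k)
    (Submodule.factor_surjective hW)

theorem isArtinian_quotient_of_isOpen (V : Submodule A U) (hV : IsOpen (V : Set U)) :
    IsArtinian A (U ⧸ V) :=
  have := finiteDimensional_quotient_of_isOpen k V hV
  isArtinian_of_finiteDimensional (k := k)

theorem isOpen_of_le {V W : Submodule A U} (h : V ≤ W)
    (hV : IsOpen (V : Set U)) : IsOpen (W : Set U) :=
  have : IsTopologicalAddGroup U := IsPseudocompactModule.toIsTopologicalAddGroup k A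
  AddSubgroup.isOpen_mono (H₁ := V.toAddSubgroup) (H₂ := W.toAddSubgroup) h hV

theorem isClosed_of_isOpen {V : Submodule A U} (hV : IsOpen (V : Set U)) :
    IsClosed (V : Set U) :=
  have : IsTopologicalAddGroup U := IsPseudocompactModule.toIsTopologicalAddGroup k A
  AddSubgroup.isClosed_of_isOpen V.toAddSubgroup hV

theorem isClosed_sup_of_isOpen (N : Submodule A U) {V : Submodule A U}
    (hV : IsOpen (V : Set U)) : IsClosed (↑(N ⊔ V) : Set U) :=
  isClosed_of_isOpen k (isOpen_of_le k le_sup_right hV)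

/-- A closed submodule is the intersection of the open submodules containing it. -/
theorem mem_of_forall_mem_sup {N : Submodule A U} (hN : IsClosed (N : Set U)) {x : U}
    (h : ∀ V : Submodule A U, IsOpen (V : Set U) → x ∈ N ⊔ V) : x ∈ N := by
  have : IsTopologicalAddGroup U := IsPseudocompactModule.toIsTopologicalAddGroup k A
  by_contra hx
  have hs : {y | x - y ∈ (N : Set U)ᶜ} ∈ 𝓝 (0 : U) :=
    (hN.isOpen_compl.preimage (continuous_const.sub continuous_id)).mem_nhds (by simpa using hx)
  obtain ⟨V, hV, _, hVs⟩ := IsPseudocompactModule.exists_submodule (k := k) (A := A) _ hs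
  obtain ⟨n, hn, y, hy, hxy⟩ := Submodule.mem_sup.1 (h V hV)
  exact hVs hy (by simpa [← hxy] using hn)

theorem exists_isOpen_notMem {x : U} (hx : x ≠ 0) :
    ∃ V : Submodule A U, IsOpen (V : Set U) ∧ x ∉ V := by
  have : T2Space U := IsPseudocompactModule.toT2Space k A
  by_contra! h
  have hc : IsClosed ((⊥ : Submodule A U) : Set U) := by simp
  exact hx (by simpa using mem_of_forall_mem_sup k hc (x := x) fun V hV ↦ by simpa using h V hV)

/-- A directed intersection of closed submodules contained in an open submodule is already
contained in it at a finite stage. -/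
theorem exists_finset_iInf_le {ι : Type*} (F : ι → Submodule A U)
    (hF : ∀ i, IsClosed (F i : Set U)) {V : Submodule A U} (hV : IsOpen (V : Set U))
    (h : ⨅ i, F i ≤ V) : ∃ t : Finset ι, ⨅ i ∈ t, F i ≤ V := by
  classical
  have := isArtinian_quotient_of_isOpen k V hV
  -- With the image in `U ⧸ V` minimal, any `w` in the intersection over `t` can be moved modulo `V`
  -- into every larger finite intersection. Linear compactness, with `none` carrying the coset `w +
  -- V`, then moves `w` modulo `V` into the full intersection, hence into `V`.
  obtain ⟨_, ⟨t, rfl⟩, hmin⟩ := IsWellFounded.wf (r := (· < · : Submodule A (U ⧸ V) → _))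
    |>.has_min (Set.range fun t : Finset ι ↦ (⨅ i ∈ t, F i).map V.mkQ) (Set.range_nonempty _)
  refine ⟨t, fun w hw ↦ ?_⟩
  obtain ⟨x, hx⟩ := exists_forall_sub_mem k (A := A) (fun o : Option ι ↦ o.elim w fun _ ↦ 0)
    (fun o ↦ o.elim V F) (fun o ↦ by cases o <;> simp [hF, isClosed_of_isOpen k hV]) (by
      intro s
      have hle : ⨅ i ∈ t ∪ s.eraseNone, F i ≤ ⨅ i ∈ t, F i :=
        biInf_mono fun i hi ↦ Finset.mem_union_left _ hi
      have heq := (Submodule.map_mono (f := V.mkQ) hle).eq_of_not_lt (hmin _ ⟨_, rfl⟩)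
      obtain ⟨y, hy, hyw⟩ := heq.ge (Submodule.mem_map_of_mem hw)
      refine ⟨y, fun o ho ↦ ?_⟩
      cases o with
      | none => exact (Submodule.Quotient.eq V).1 hyw
      | some i =>
        simp only [SetLike.mem_coe, Submodule.mem_iInf] at hy
        simpa using hy i (Finset.mem_union_right _ (by simpa using ho)))
  have hxV : x ∈ V := h ((Submodule.mem_iInf _).2 fun i ↦ by simpa using hx (some i))
  simpa using V.sub_mem hxV (hx none)

/-- A closed submodule of finite codimension is open. -/
theorem isOpen_of_isClosed_of_finiteDimensional {N : Submodule A U} (hN : IsClosed (N : Set U))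
    [FiniteDimensional k (U ⧸ N)] : IsOpen (N : Set U) := by
  have := isArtinian_of_finiteDimensional (k := k) (A := A) (M := U ⧸ N)
  -- An open `V` with minimal image in `U ⧸ N` lies in `N`: shrinking it to `V ⊓ W` does not change
  -- the image, so `V ≤ N ⊔ W` for every open `W`.
  obtain ⟨_, ⟨V, hV, rfl⟩, hmin⟩ := IsWellFounded.wf (r := (· < · : Submodule A (U ⧸ N) → _))
    |>.has_min ((fun V : Submodule A U ↦ V.map N.mkQ) '' {V | IsOpen (V : Set U)})
    ⟨_, ⊤, by simp, rfl⟩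
  refine isOpen_of_le k (V := V) (fun x hx ↦ mem_of_forall_mem_sup k hN fun W hW ↦ ?_) hV
  have heq := (Submodule.map_mono (f := N.mkQ) (inf_le_left : V ⊓ W ≤ V)).eq_of_not_lt
    (hmin _ ⟨_, hV.inter hW, rfl⟩)
  obtain ⟨y, hy, hyx⟩ := heq.ge (Submodule.mem_map_of_mem hx)
  have := (Submodule.Quotient.eq N).1 hyx
  rw [← sub_sub_cancel y x]
  exact sub_mem (Submodule.mem_sup_right hy.2) (Submodule.mem_sup_left this)

/-- The sum of a closed submodule and the image of a closed submodule is closed. -/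
theorem isClosed_map_sup {M : Type w₁} [AddCommGroup M] [Module k M] [Module A M]
    [IsScalarTower k A M] [TopologicalSpace M] [IsPseudocompactModule k A M] (f : M →L[A] U)
    {P : Submodule A M} (hP : IsClosed (P : Set M)) {Q : Submodule A U}
    (hQ : IsClosed (Q : Set U)) : IsClosed (↑(P.map f.toLinearMap ⊔ Q) : Set U) := by
  classical
  have : IsTopologicalAddGroup U := IsPseudocompactModule.toIsTopologicalAddGroup k A
  refine isClosed_of_closure_subset fun x hx ↦ ?_
  have hex : ∀ V : {V : Submodule A U // IsOpen (V : Set U)}, ∃ p ∈ P, x - f p ∈ Q ⊔ V.1 := by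
    intro V
    have : {y | x - y ∈ V.1} ∈ 𝓝 x := (V.2.preimage (continuous_const.sub continuous_id)).mem_nhds
      (by simp)
    obtain ⟨y, hyV, hy⟩ := mem_closure_iff_nhds.1 hx _ this
    obtain ⟨_, ⟨p, hp, rfl⟩, q, hq, rfl⟩ := Submodule.mem_sup.1 hy
    refine ⟨p, hp, ?_⟩
    have : x - f p = q + (x - (f p + q)) := by abel
    rw [this]
    exact add_mem (Submodule.mem_sup_left hq) (Submodule.mem_sup_right hyV)
  choose p hp hpx using hex
  -- Each `p V` solves the problem modulo `V`, and the solutions modulo `V` inside `P` form its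
  -- coset. Finitely many of these cosets meet because a finite intersection of open submodules is
  -- open.
  obtain ⟨y, hy⟩ := exists_forall_sub_mem k (A := A) p
    (fun V ↦ P ⊓ (Q ⊔ V.1).comap f.toLinearMap)
    (fun V ↦ hP.inter ((isClosed_sup_of_isOpen k Q V.2).preimage f.continuous)) (by
      intro s
      let W : {V : Submodule A U // IsOpen (V : Set U)} :=
        ⟨⨅ V ∈ s, V.1, by
          simp only [Submodule.coe_iInf]
          exact isOpen_biInter_finset fun V _ ↦ V.2⟩
      refine ⟨p W, fun V hV ↦ ⟨sub_mem (hp _) (hp _), ?_⟩⟩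
      have hW : W.1 ≤ V.1 := biInf_le (fun V : {V : Submodule A U // IsOpen (V : Set U)} ↦ V.1) hV
      have := sub_mem (hpx V) (sup_le_sup_left hW Q (hpx W))
      simpa using this)
  have hy0 : y ∈ P := by
    have := add_mem (hy ⟨⊤, by simp⟩).1 (hp ⟨⊤, by simp⟩)
    simpa using this
  have hxy : x - f y ∈ Q := mem_of_forall_mem_sup k hQ fun V hV ↦ by
    have := sub_mem (hpx ⟨V, hV⟩) (hy ⟨V, hV⟩).2
    simpa using this
  rw [← add_sub_cancel (f y) x]
  exact add_mem (Submodule.mem_sup_left ⟨y, hy0, rfl⟩) (Submodule.mem_sup_right hxy)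

end Modules

/-- The quotients of `A` by its open left ideals are semisimple `A`-modules. -/
def HasSemisimpleQuotients (A : Type v) [Ring A] [TopologicalSpace A] : Prop :=
  ∀ V : Ideal A, IsOpen (V : Set A) → IsSemisimpleModule A (A ⧸ V)

instance isPseudocompactModule_self (k : Type u) (A : Type v) [Field k] [Ring A] [Algebra k A]
    [TopologicalSpace A] [h : IsPseudocompactAlgebra k A] : IsPseudocompactModule k A A where
  toIsTopologicalAddGroup := h.toIsTopologicalRing.to_topologicalAddGroup
  toContinuousSMul := ⟨h.toIsTopologicalRing.toContinuousMul.continuous_mul⟩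
  toT2Space := h.toT2Space
  exists_submodule s hs := (h.exists_ideal s hs).imp fun _ hI ↦ hI.2
  complete := h.complete

/-! ### Closed complements and continuous splittings -/

section Modules

variable (k : Type u) {A : Type v} {U : Type w} [Field k] [Ring A] [Algebra k A]
  [TopologicalSpace A] [AddCommGroup U] [Module k U] [Module A U] [IsScalarTower k A U]
  [TopologicalSpace U] [IsPseudocompactModule k A U]

include k

/-- The quotient is the sum of its cyclic submodules, and each of them is `A` modulo an annihilator,
which is open by continuity of the action. -/
theorem HasSemisimpleQuotients.isSemisimpleModule_quotient (hA : HasSemisimpleQuotients A)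
    {V : Submodule A U} (hV : IsOpen (V : Set U)) : IsSemisimpleModule A (U ⧸ V) := by
  have : ContinuousSMul A U := IsPseudocompactModule.toContinuousSMul k
  let f : U → A →ₗ[A] U ⧸ V := fun x ↦ LinearMap.toSpanSingleton A _ (V.mkQ x)
  refine isSemisimpleModule_of_isSemisimpleModule_submodule' (p := fun x ↦ (f x).range)
    (fun x ↦ ?_) (eq_top_iff.2 fun y _ ↦ ?_)
  · have hx : IsOpen ((f x).ker : Set A) := by
      convert hV.preimage (continuous_id.smul continuous_const : Continuous fun a : A ↦ a • x)
      ext a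
      exact Submodule.Quotient.mk_eq_zero V
    have := hA _ hx
    exact IsSemisimpleModule.congr (f x).quotKerEquivRange.symm
  · obtain ⟨x, rfl⟩ := V.mkQ_surjective y
    exact Submodule.mem_iSup_of_mem x ⟨1, by simp [f]⟩

/-- A minimal closed `L` with `N ⊔ L = ⊤` is a complement. If `N ⊓ L` contained `x ≠ 0`, choose an
open `V` missing `x` and a complement `C` of the image of `N ⊓ L` in `U ⧸ V`. Cutting `L` down to
the preimage of `C` keeps the sum equal to `⊤` but removes `x`. -/
theorem HasSemisimpleQuotients.exists_isClosed_isCompl (hA : HasSemisimpleQuotients A)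
    {N : Submodule A U} (hN : IsClosed (N : Set U)) :
    ∃ L : Submodule A U, IsClosed (L : Set U) ∧ IsCompl N L := by
  obtain ⟨L, -, hL⟩ := zorn_le_nonempty₀ (α := (Submodule A U)ᵒᵈ)
    {L | IsClosed (L.ofDual : Set U) ∧ N ⊔ L.ofDual = ⊤} (by
      intro c hc hchain L₀ hL₀
      refine ⟨.toDual (⨅ L : c, L.1.ofDual), ⟨?_, ?_⟩, fun L hL ↦
        (iInf_le (fun L : c ↦ L.1.ofDual) ⟨L, hL⟩ :)⟩
      · simp only [OrderDual.ofDual_toDual, Submodule.coe_iInf]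
        exact isClosed_iInter fun L ↦ (hc L.2).1
      · refine eq_top_iff.2 fun x _ ↦ ?_
        -- The coset `x + N` meets each member of the chain, so it meets their intersection.
        obtain ⟨y, hy⟩ := exists_forall_sub_mem k (A := A)
          (fun o : Option c ↦ o.elim x fun _ ↦ 0) (fun o ↦ o.elim N fun L ↦ L.1.ofDual)
          (fun o ↦ by
            cases o with
            | none => exact hN
            | some L => exact (hc L.2).1) (by
          intro t
          have : Nonempty c := ⟨⟨L₀, hL₀⟩⟩
          obtain ⟨L, hL⟩ := (hchain.directedOn.directed_val).finset_le t.eraseNone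
          obtain ⟨n, hn, l, hl, hnl⟩ := Submodule.mem_sup.1
            ((hc L.2).2.ge (Submodule.mem_top (x := x)))
          refine ⟨l, fun o ho ↦ ?_⟩
          cases o with
          | none => simpa [← hnl] using hn
          | some L' =>
            have : L.1.ofDual ≤ L'.1.ofDual := hL L' (by simpa using ho)
            simpa using this hl)
        have h1 : x - y ∈ N := by simpa using N.neg_mem (hy none)
        rw [← sub_add_cancel x y]
        exact add_mem (Submodule.mem_sup_left h1) (Submodule.mem_sup_right
          ((Submodule.mem_iInf _).2 fun L ↦ by simpa using hy (some L))))
    (.toDual ⊤) ⟨isClosed_univ, sup_top_eq N⟩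
  obtain ⟨L, rfl⟩ := OrderDual.toDual.surjective L
  refine ⟨L, hL.1.1, disjoint_iff.2 ((Submodule.eq_bot_iff _).2 fun x hx ↦ ?_),
    codisjoint_iff.2 hL.1.2⟩
  by_contra hx0
  obtain ⟨V, hV, hxV⟩ := exists_isOpen_notMem k (A := A) hx0
  have := hA.isSemisimpleModule_quotient k hV
  obtain ⟨C, hC⟩ := exists_isCompl ((N ⊓ L).map V.mkQ)
  have hopen : IsOpen (C.comap V.mkQ : Set U) :=
    isOpen_of_le k (V := V) (fun y hy ↦ by simp [(Submodule.Quotient.mk_eq_zero V).2 hy]) hV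
  have hL' : IsClosed (↑(L ⊓ C.comap V.mkQ) : Set U) := hL.1.1.inter (isClosed_of_isOpen k hopen)
  have hle : L ≤ N ⊔ (L ⊓ C.comap V.mkQ) := by
    intro l hl
    obtain ⟨_, ⟨n, hn, rfl⟩, c, hc, hlc⟩ := Submodule.mem_sup.1
      (hC.sup_eq_top.ge (Submodule.mem_top (x := V.mkQ l)))
    rw [← add_sub_cancel n l]
    refine add_mem (Submodule.mem_sup_left hn.1) (Submodule.mem_sup_right ⟨L.sub_mem hl hn.2, ?_⟩)
    rw [SetLike.mem_coe, Submodule.mem_comap, map_sub, ← hlc, add_sub_cancel_left]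
    exact hc
  have hmin : L ≤ L ⊓ C.comap V.mkQ := hL.2 (y := .toDual (L ⊓ C.comap V.mkQ))
    ⟨hL', eq_top_iff.2 (hL.1.2.ge.trans (sup_le le_sup_left hle))⟩
    (inf_le_left : L ⊓ C.comap V.mkQ ≤ L)
  have h0 : V.mkQ x ∈ (N ⊓ L).map V.mkQ ⊓ C :=
    ⟨Submodule.mem_map_of_mem hx, (hmin hx.2).2⟩
  rw [hC.inf_eq_bot, Submodule.mem_bot] at h0
  exact hxV ((Submodule.Quotient.mk_eq_zero V).1 h0)

variable {M : Type w₁} [AddCommGroup M] [Module k M] [Module A M]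
    [IsScalarTower k A M] [TopologicalSpace M] [IsPseudocompactModule k A M]

/-- A homomorphism is continuous as soon as the preimages of open submodules are closed. -/
theorem continuous_of_isClosed_comap (h : U →ₗ[A] M)
    (hc : ∀ V : Submodule A M, IsOpen (V : Set M) → IsClosed (V.comap h : Set U)) :
    Continuous h := by
  have : IsTopologicalAddGroup U := IsPseudocompactModule.toIsTopologicalAddGroup k A
  have : IsTopologicalAddGroup M := IsPseudocompactModule.toIsTopologicalAddGroup k A
  refine continuous_of_continuousAt_zero h ?_
  intro s hs
  rw [map_zero] at hs
  obtain ⟨V, hV, _, hVs⟩ := IsPseudocompactModule.exists_submodule (k := k) (A := A) s hs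
  -- The preimage of `V` has finite codimension because `U ⧸ V.comap h` embeds in `M ⧸ V`; being
  -- closed, it is then open.
  have : FiniteDimensional k (U ⧸ V.comap h) :=
    Module.Finite.of_injective (((V.comap h).mapQ V h le_rfl).restrictScalars k)
      (LinearMap.ker_eq_bot.1 (by
        rw [LinearMap.ker_restrictScalars, Submodule.ker_mapQ, Submodule.mkQ_map_self]; rfl))
  have := isOpen_of_isClosed_of_finiteDimensional k (hc V hV)
  exact Filter.mem_of_superset (this.mem_nhds (by simp)) fun x hx ↦ hVs hx

/-- A closed complement `L` of the kernel maps bijectively onto `M`. The inverse is continuous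
because the preimage of an open `V` under it is the image of `V ⊓ L`, which is closed. -/
theorem HasSemisimpleQuotients.exists_rightInverse (hA : HasSemisimpleQuotients A)
    (f : U →L[A] M) (hf : Function.Surjective f) : ∃ s : M →L[A] U, ∀ x, f (s x) = x := by
  have : T2Space M := IsPseudocompactModule.toT2Space k A
  obtain ⟨L, hL, hc⟩ := hA.exists_isClosed_isCompl k
    (N := f.ker) (isClosed_singleton.preimage f.continuous)
  let g : L →ₗ[A] M := f.toLinearMap.domRestrict L
  have hg : Function.Bijective g := by
    constructor
    · refine (injective_iff_map_eq_zero g).2 fun x hx ↦ Subtype.ext ?_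
      exact (Submodule.disjoint_def.1 hc.disjoint) _ hx x.2
    · intro y
      obtain ⟨x, rfl⟩ := hf y
      obtain ⟨a, ha, b, hb, rfl⟩ := Submodule.mem_sup.1
        (hc.sup_eq_top.ge (Submodule.mem_top (x := x)))
      have ha : f a = 0 := ha
      exact ⟨⟨b, hb⟩, by simp [g, ha]⟩
  let e := LinearEquiv.ofBijective g hg
  have hfe : ∀ x, f (e.symm x) = x := e.apply_symm_apply
  let s : M →ₗ[A] U := L.subtype ∘ₗ e.symm.toLinearMap
  have hs : Continuous s := by
    refine continuous_of_isClosed_comap k s fun V hV ↦ ?_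
    have := isClosed_map_sup k f (P := V ⊓ L) ((isClosed_of_isOpen k hV).inter hL) (Q := ⊥)
      isClosed_singleton
    convert this using 2
    rw [sup_bot_eq]
    ext x
    constructor
    · exact fun hx ↦ ⟨s x, ⟨hx, (e.symm x).2⟩, hfe x⟩
    · rintro ⟨l, hl, rfl⟩
      have : e.symm (f l) = ⟨l, hl.2⟩ := e.symm_apply_eq.2 rfl
      change ((e.symm (f l) : L) : U) ∈ V
      rw [this]
      exact hl.1
  exact ⟨⟨s, hs⟩, hfe⟩

/-- The range is closed, so it has a closed complement `L`. Projecting along `L` and inverting `f`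
is continuous because the preimage of `V` is `f(V) + L`, which is closed. -/
theorem HasSemisimpleQuotients.exists_leftInverse (hA : HasSemisimpleQuotients A)
    (f : U →L[A] M) (hf : Function.Injective f) : ∃ s : M →L[A] U, ∀ x, s (f x) = x := by
  have : T2Space M := IsPseudocompactModule.toT2Space k A
  have hR : IsClosed (f.range : Set M) := by
    have := isClosed_map_sup k f (P := ⊤) isClosed_univ (Q := ⊥) isClosed_singleton
    rwa [sup_bot_eq, Submodule.map_top] at this
  obtain ⟨L, hL, hc⟩ := hA.exists_isClosed_isCompl k hR
  let e := LinearEquiv.ofInjective f.toLinearMap hf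
  let s : M →ₗ[A] U := e.symm.toLinearMap ∘ₗ f.range.projectionOnto L hc
  have hsf : ∀ x, s (f x) = x := fun x ↦ by
    have : f.range.projectionOnto L hc (f x) = e x :=
      Submodule.projectionOnto_apply_left hc (e x)
    simp [s, this]
  have hsL : ∀ x ∈ L, s x = 0 := fun x hx ↦ by
    simp [s, (Submodule.projectionOnto_apply_eq_zero_iff hc).2 hx]
  have hs : Continuous s := by
    refine continuous_of_isClosed_comap k s fun V hV ↦ ?_
    convert isClosed_map_sup k f (P := V) (isClosed_of_isOpen k hV) hL using 2
    ext x
    rw [Submodule.mem_comap, Submodule.mem_sup]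
    constructor
    · intro hx
      obtain ⟨_, ⟨a, rfl⟩, b, hb, rfl⟩ := Submodule.mem_sup.1
        (hc.sup_eq_top.ge (Submodule.mem_top (x := x)))
      have : s (f a + b) = a := by rw [map_add, hsf, hsL b hb, add_zero]
      exact ⟨_, ⟨a, this ▸ hx, rfl⟩, b, hb, rfl⟩
    · rintro ⟨_, ⟨a, ha, rfl⟩, b, hb, rfl⟩
      have : s (f a + b) = a := by rw [map_add, hsf, hsL b hb, add_zero]
      exact this.symm ▸ ha
  exact ⟨⟨s, hs⟩, hsf⟩

end Modules

/-! ### Consequences of semisimple quotients -/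

section Implications

variable (k : Type u) {A : Type v} [Field k] [Ring A] [Algebra k A] [TopologicalSpace A]

theorem HasSemisimpleQuotients.everyModuleProjective (hA : HasSemisimpleQuotients A) :
    EveryModuleProjective k A := by
  intro U _ _ _ _ _ _ M N _ _ _ _ _ _ _ _ _ _ _ _ f g hf
  obtain ⟨s, hs⟩ := hA.exists_rightInverse k f hf
  exact ⟨s.comp g, ContinuousLinearMap.ext fun x ↦ hs (g x)⟩

theorem HasSemisimpleQuotients.everyModuleInjective (hA : HasSemisimpleQuotients A) :
    EveryModuleInjective k A := by
  intro U _ _ _ _ _ _ M N _ _ _ _ _ _ _ _ _ _ _ _ f g hf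
  obtain ⟨s, hs⟩ := hA.exists_leftInverse k f hf
  exact ⟨g.comp s, ContinuousLinearMap.ext fun x ↦ congrArg g (hs x)⟩

theorem HasSemisimpleQuotients.isTopologicallySemisimple [IsPseudocompactAlgebra k A]
    (hA : HasSemisimpleQuotients A) : IsTopologicallySemisimple A :=
  fun _ hI ↦ hA.exists_isClosed_isCompl k hI

end Implications

/- These instances leave `k` and `A` to be guessed, which makes searches for topological
instances expensive. -/
attribute [-instance] IsPseudocompactModule.toT2Space IsPseudocompactAlgebra.toT2Space
  IsPseudocompactModule.toIsTopologicalAddGroup IsPseudocompactModule.toContinuousSMul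
  IsPseudocompactAlgebra.toIsTopologicalRing IsSimplePseudocompactModule.toNontrivial
  IsSimplePseudocompactModule.toIsPseudocompactModule

/-! ### Discrete finite-dimensional modules -/

section Discrete

variable (k : Type u) {A : Type v} {U : Type w} [Field k] [Ring A] [Algebra k A]
  [TopologicalSpace A] [AddCommGroup U] [Module k U] [Module A U] [IsScalarTower k A U]
  [TopologicalSpace U] [DiscreteTopology U]

omit [Algebra k A] in
theorem continuousSMul_of_discreteTopology [IsTopologicalRing A]
    (h : ∀ x : U, IsOpen ((LinearMap.toSpanSingleton A U x).ker : Set A)) :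
    ContinuousSMul A U := by
  refine ⟨continuous_prod_of_discrete_right.2 fun x ↦ ?_⟩
  refine continuous_of_continuousAt_zero (LinearMap.toSpanSingleton A U x) fun s hs ↦ ?_
  rw [map_zero] at hs
  refine Filter.mem_map.2 (Filter.mem_of_superset ((h x).mem_nhds (zero_mem _)) fun a ha ↦ ?_)
  rw [Set.mem_preimage, show LinearMap.toSpanSingleton A U x a = 0 from ha]
  exact mem_of_mem_nhds hs

/-- A discrete finite-dimensional topological module is pseudocompact. -/
theorem isPseudocompactModule_of_discreteTopology [ContinuousSMul A U] [FiniteDimensional k U] :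
    IsPseudocompactModule k A U where
  exists_submodule s hs := ⟨⊥, isOpen_discrete _, inferInstance, by
    simpa using mem_of_mem_nhds hs⟩
  complete := by
    let _ := IsTopologicalAddGroup.rightUniformSpace U
    have := isUniformAddGroup_of_addCommGroup (G := U)
    exact IsRightUniformAddGroup.completeSpace_of_weaklyLocallyCompactSpace

end Discrete

/-! ### Semisimple quotients from projectivity or injectivity -/

section Splitting

variable (k : Type u) {A : Type v} [Field k] [Ring A] [Algebra k A] [TopologicalSpace A]
  [IsPseudocompactAlgebra k A]

include k in
theorem isOpen_ker_toSpanSingleton_quotient {I : Ideal A} (hI : IsOpen (I : Set A)) (x : A ⧸ I) :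
    IsOpen ((LinearMap.toSpanSingleton A _ x).ker : Set A) := by
  have : IsTopologicalRing A := IsPseudocompactAlgebra.toIsTopologicalRing k
  obtain ⟨x, rfl⟩ := I.mkQ_surjective x
  convert hI.preimage (continuous_id.mul continuous_const : Continuous fun a : A ↦ a * x)
  ext a
  exact Submodule.Quotient.mk_eq_zero I

theorem EveryModuleProjective.hasSemisimpleQuotients (h : EveryModuleProjective k A) :
    HasSemisimpleQuotients A := by
  have : IsTopologicalRing A := IsPseudocompactAlgebra.toIsTopologicalRing k
  intro I hI
  let _ : TopologicalSpace (A ⧸ I) := ⊥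
  have : DiscreteTopology (A ⧸ I) := ⟨rfl⟩
  have := finiteDimensional_quotient_of_isOpen k I hI
  have : ContinuousSMul A (A ⧸ I) :=
    continuousSMul_of_discreteTopology (isOpen_ker_toSpanSingleton_quotient k hI)
  have : IsPseudocompactModule k A (A ⧸ I) := isPseudocompactModule_of_discreteTopology k
  refine { exists_isCompl := fun N ↦ ?_ }
  let _ : TopologicalSpace ((A ⧸ I) ⧸ N) := ⊥
  have : DiscreteTopology ((A ⧸ I) ⧸ N) := ⟨rfl⟩
  have : ContinuousSMul A ((A ⧸ I) ⧸ N) := continuousSMul_of_discreteTopology fun x ↦ by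
    obtain ⟨x, rfl⟩ := N.mkQ_surjective x
    refine isOpen_of_le k (fun a ha ↦ ?_) (isOpen_ker_toSpanSingleton_quotient k hI x)
    have : a • x = 0 := ha
    change a • N.mkQ x = 0
    rw [← map_smul, this, map_zero]
  have : IsPseudocompactModule k A ((A ⧸ I) ⧸ N) := isPseudocompactModule_of_discreteTopology k
  -- Projectivity of the discrete module `(A ⧸ I) ⧸ N` gives a section of `N.mkQ`; subtracting it
  -- from the identity retracts `A ⧸ I` onto `N`.
  obtain ⟨s, hs⟩ := h _ _ _ ⟨N.mkQ, continuous_of_discreteTopology⟩ (.id A ((A ⧸ I) ⧸ N))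
    N.mkQ_surjective
  have hs : ∀ x, N.mkQ (s x) = x := fun x ↦ congrArg (fun f ↦ f x) hs
  let r : (A ⧸ I) →ₗ[A] N := (LinearMap.id - s.toLinearMap ∘ₗ N.mkQ).codRestrict N fun x ↦ by
    rw [← Submodule.Quotient.mk_eq_zero N, ← Submodule.mkQ_apply]
    simp [-Submodule.mkQ_apply, hs]
  refine ⟨r.ker, LinearMap.isCompl_of_proj fun x ↦ Subtype.ext ?_⟩
  have : N.mkQ x = 0 := (Submodule.Quotient.mk_eq_zero N).2 x.2
  simp [r, -Submodule.mkQ_apply, this]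

theorem EveryModuleInjective.hasSemisimpleQuotients (h : EveryModuleInjective k A) :
    HasSemisimpleQuotients A := by
  have : IsTopologicalRing A := IsPseudocompactAlgebra.toIsTopologicalRing k
  intro I hI
  let _ : TopologicalSpace (A ⧸ I) := ⊥
  have : DiscreteTopology (A ⧸ I) := ⟨rfl⟩
  have := finiteDimensional_quotient_of_isOpen k I hI
  have : ContinuousSMul A (A ⧸ I) :=
    continuousSMul_of_discreteTopology (isOpen_ker_toSpanSingleton_quotient k hI)
  have : IsPseudocompactModule k A (A ⧸ I) := isPseudocompactModule_of_discreteTopology k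
  refine { exists_isCompl := fun N ↦ ?_ }
  have : FiniteDimensional k N :=
    Module.Finite.of_injective (N.subtype.restrictScalars k) N.subtype_injective
  have : IsPseudocompactModule k A N := isPseudocompactModule_of_discreteTopology k
  -- Injectivity of `N` extends its identity to a retraction of `A ⧸ I` onto `N`.
  obtain ⟨r, hr⟩ := h _ _ _ ⟨N.subtype, continuous_of_discreteTopology⟩ (.id A N)
    N.subtype_injective
  exact ⟨r.ker, LinearMap.isCompl_of_proj (f := r.toLinearMap) fun x ↦
    congrArg (fun f ↦ f x) hr⟩

end Splitting

/-! ### The topological radical -/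

section Jacobson

variable (k : Type u) {A : Type v} [Field k] [Ring A] [Algebra k A] [TopologicalSpace A]
  [IsPseudocompactAlgebra k A]

include k

/-- Since `I` is closed and misses `1`, so does `I ⊔ V` for some open `V`. A maximal left ideal
above `I ⊔ V` contains `V`, hence is open. -/
theorem exists_isMaximal_of_isClosed {I : Ideal A} (hI : IsClosed (I : Set A)) (hne : I ≠ ⊤) :
    ∃ M : Ideal A, I ≤ M ∧ IsOpen (M : Set A) ∧ M.IsMaximal := by
  have : ∃ V : Ideal A, IsOpen (V : Set A) ∧ I ⊔ V ≠ ⊤ := by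
    by_contra! h
    exact hne ((Ideal.eq_top_iff_one I).2
      (mem_of_forall_mem_sup k hI fun V hV ↦ by simp [h V hV]))
  obtain ⟨V, hV, hIV⟩ := this
  obtain ⟨M, hM, hle⟩ := Ideal.exists_le_maximal _ hIV
  exact ⟨M, le_sup_left.trans hle, isOpen_of_le k (le_sup_right.trans hle) hV, hM⟩

theorem isMaximalClosed_iff {I : Ideal A} :
    IsMaximalClosed I ↔ IsOpen (I : Set A) ∧ I.IsMaximal := by
  constructor
  · intro h
    obtain ⟨M, hle, hM, hmax⟩ := exists_isMaximal_of_isClosed k h.1.1 h.1.2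
    rw [le_antisymm hle (h.2 ⟨isClosed_of_isOpen k hM, hmax.ne_top⟩ hle)]
    exact ⟨hM, hmax⟩
  · rintro ⟨hI, hmax⟩
    exact ⟨⟨isClosed_of_isOpen k hI, hmax.ne_top⟩,
      fun J hJ hle ↦ (hmax.eq_of_le hJ.2 hle).ge⟩

/-- If the radical were nonzero, its closed complement would be proper and so lie in an open maximal
left ideal, which also contains the radical and would thus be everything. -/
theorem IsTopologicallySemisimple.topJacobson_eq_bot (h : IsTopologicallySemisimple A) :
    topJacobson A = ⊥ := by
  have hJ : IsClosed (topJacobson A : Set A) := by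
    simp only [topJacobson, Submodule.coe_sInf]
    exact isClosed_biInter fun I hI ↦ hI.1.1
  obtain ⟨L, hL, hc⟩ := h _ hJ
  by_contra hne
  have hL1 : L ≠ ⊤ := fun hL1 ↦ hne (by simpa [hL1] using hc.inf_eq_bot)
  obtain ⟨M, hle, hM, hmax⟩ := exists_isMaximal_of_isClosed k hL hL1
  exact hmax.ne_top (top_le_iff.1 (hc.sup_eq_top.ge.trans
    (sup_le (sInf_le ((isMaximalClosed_iff k).2 ⟨hM, hmax⟩)) hle)))

theorem hasSemisimpleQuotients_of_topJacobson_eq_bot (h : topJacobson A = ⊥) :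
    HasSemisimpleQuotients A := by
  intro V hV
  obtain ⟨t, ht⟩ := exists_finset_iInf_le k (fun I : {I : Ideal A // IsMaximalClosed I} ↦ I.1)
    (fun I ↦ I.2.1.1) hV (by
      exact (sInf_eq_iInf' {I : Ideal A | IsMaximalClosed I}).ge.trans (h.le.trans bot_le))
  have hs : ∀ I : t, IsSimpleModule A (A ⧸ I.1.1) := fun I ↦
    isSimpleModule_iff_isCoatom.2 ((isMaximalClosed_iff k).1 I.1.2).2.out
  let g : A →ₗ[A] ∀ I : t, A ⧸ I.1.1 := LinearMap.pi fun I ↦ I.1.1.mkQ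
  have hg : g.ker ≤ V := by
    refine le_trans (fun x hx ↦ ?_) ht
    simp only [Submodule.mem_iInf]
    intro I hI
    exact (Submodule.Quotient.mk_eq_zero _).1 (congrFun (LinearMap.mem_ker.1 hx) ⟨I, hI⟩)
  have : IsSemisimpleModule A (A ⧸ g.ker) :=
    IsSemisimpleModule.of_injective (g.ker.liftQ g le_rfl)
      (LinearMap.ker_eq_bot.1 (Submodule.ker_liftQ_eq_bot _ _ _ le_rfl))
  exact IsSemisimpleModule.of_surjective (Submodule.factor hg) (Submodule.factor_surjective hg)

omit [IsPseudocompactAlgebra k A] in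
-- The coordinate kernels intersect in zero, and each is maximal closed: a closed left ideal
-- containing the kernel of the `i`-th coordinate is determined by its preimage in `S i`, a closed
-- submodule of a simple module.
theorem IsProductOfSimples.topJacobson_eq_bot (h : IsProductOfSimples k A) :
    topJacobson A = ⊥ := by
  classical
  obtain ⟨ι, S, _, _, _, _, _, hS, ⟨e⟩⟩ := h
  have hker : ∀ i, IsMaximalClosed
      (((ContinuousLinearMap.proj (φ := S) i).comp e.toContinuousLinearMap : A →L[A] S i).ker) := by
    intro i
    have : T2Space (S i) := (hS i).toT2Space
    have : Nontrivial (S i) := (hS i).toNontrivial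
    refine ⟨⟨isClosed_singleton.preimage (ContinuousLinearMap.continuous _), fun htop ↦ ?_⟩,
      fun L hL hle ↦ ?_⟩
    · obtain ⟨x, hx⟩ := exists_ne (0 : S i)
      have := htop.ge (Submodule.mem_top (x := e.symm (Pi.single i x)))
      exact hx (by simpa using this)
    · let c : S i →L[A] A := e.symm.toContinuousLinearMap.comp (ContinuousLinearMap.single A S i)
      have hdecomp : ∀ a, a - c (e a i) ∈ L := fun a ↦ hle (by simp [c])
      rcases (hS i).eq_bot_or_eq_top (Submodule.comap c.toLinearMap L)
        (hL.1.preimage c.continuous) with h0 | h1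
      · intro a ha
        have : e a i ∈ Submodule.comap c.toLinearMap L := by
          have := L.sub_mem ha (hdecomp a)
          simpa using this
        rw [h0] at this
        simpa using this
      · refine absurd (eq_top_iff.2 fun a _ ↦ ?_) hL.2
        have : c (e a i) ∈ L := h1.ge (Submodule.mem_top (x := e a i))
        simpa using add_mem (hdecomp a) this
  refine (Submodule.eq_bot_iff _).2 fun x hx ↦ e.map_eq_zero_iff.1 (funext fun i ↦ ?_)
  exact (Submodule.mem_sInf.1 hx) _ (hker i)

end Jacobson

/-! ### Semisimple and simple quotient rings -/

section Rings

variable {A : Type*} {R : Type*} [Ring A] [Ring R]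

theorem isSemisimpleModule_quotient_ker (p : A →+* R) (hp : Function.Surjective p)
    [IsSemisimpleRing R] : IsSemisimpleModule A (A ⧸ RingHom.ker p) := by
  have : RingHomSurjective p := ⟨hp⟩
  let l₀ : A →ₛₗ[p] R := { toFun := p, map_add' := map_add p, map_smul' := map_mul p }
  have hl : RingHom.ker p = l₀.ker := rfl
  let l : (A ⧸ RingHom.ker p) →ₛₗ[p] R := (RingHom.ker p).liftQ l₀ hl.le
  refine (LinearMap.isSemisimpleModule_iff_of_bijective l ⟨?_, ?_⟩).2 inferInstance
  · exact LinearMap.ker_eq_bot.1 (Submodule.ker_liftQ_eq_bot _ _ _ hl.ge)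
  · intro y
    obtain ⟨x, rfl⟩ := hp y
    exact ⟨Submodule.Quotient.mk x, rfl⟩

theorem isSemisimpleRing_quotient (I : Ideal A) [I.IsTwoSided]
    [h : IsSemisimpleModule A (A ⧸ I)] : IsSemisimpleRing (A ⧸ I) := by
  have : RingHomSurjective (Ideal.Quotient.mk I) := ⟨Ideal.Quotient.mk_surjective⟩
  let l : (A ⧸ I) →ₛₗ[Ideal.Quotient.mk I] (A ⧸ I) :=
    { toFun := id
      map_add' := fun _ _ ↦ rfl
      map_smul' := fun a x ↦ by
        obtain ⟨x, rfl⟩ := Ideal.Quotient.mk_surjective x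
        rfl }
  exact (LinearMap.isSemisimpleModule_iff_of_bijective l Function.bijective_id).1 h

/-- The Chinese remainder theorem for two-sided ideals of a noncommutative ring. -/
theorem exists_forall_sub_mem_of_sup_eq_top {ι : Type*} (I : ι → Ideal A)
    [∀ i, (I i).IsTwoSided] (hI : Pairwise fun i j ↦ I i ⊔ I j = ⊤) (c : ι → A) (t : Finset ι) :
    ∃ x, ∀ i ∈ t, x - c i ∈ I i := by
  classical
  -- The element `e` is `1` modulo `I i` and `0` modulo every `I j` with `j ∈ t`; it corrects a
  -- solution at `i` without disturbing the others.
  have key : ∀ (i : ι) (t : Finset ι), i ∉ t → ∃ e, 1 - e ∈ I i ∧ ∀ j ∈ t, e ∈ I j := by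
    intro i t
    induction t using Finset.induction_on with
    | empty => exact fun _ ↦ ⟨1, by simp, by simp⟩
    | insert j t _ ih =>
      intro hit
      rw [Finset.mem_insert, not_or] at hit
      obtain ⟨e, he, het⟩ := ih hit.2
      obtain ⟨a, ha, b, hb, hab⟩ := Submodule.mem_sup.1
        ((hI hit.1).ge (Submodule.mem_top (x := (1 : A))))
      refine ⟨e * b, ?_, fun l hl ↦ ?_⟩
      · have : 1 - e * b = (1 - e) + e * a := by
          rw [eq_sub_of_add_eq hab, mul_sub, mul_one]; abel
        rw [this]
        exact add_mem he ((I i).mul_mem_left _ ha)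
      · rcases Finset.mem_insert.1 hl with rfl | hl
        · exact (I l).mul_mem_left _ hb
        · exact (I l).mul_mem_right _ (het l hl)
  induction t using Finset.induction_on with
  | empty => exact ⟨0, by simp⟩
  | insert i t hi ih =>
    obtain ⟨x, hx⟩ := ih
    obtain ⟨e, he, het⟩ := key i t hi
    refine ⟨x + e * (c i - x), fun j hj ↦ ?_⟩
    rcases Finset.mem_insert.1 hj with rfl | hj
    · have : x + e * (c j - x) - c j = (1 - e) * (x - c j) := by noncomm_ring
      rw [this]
      exact (I j).mul_mem_right _ he
    · rw [add_sub_right_comm]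
      exact add_mem (hx j hj) ((I j).mul_mem_right _ (het j hj))

/-- The image of `J` in the simple ring `A ⧸ I` is zero or everything, so `J ≤ I` or the two are
coprime; the same holds with the roles exchanged. -/
theorem sup_eq_top_of_isSimpleRing_quotient {I J : Ideal A} [I.IsTwoSided] [J.IsTwoSided]
    [hI : IsSimpleRing (A ⧸ I)] [hJ : IsSimpleRing (A ⧸ J)] (hne : I ≠ J) : I ⊔ J = ⊤ := by
  have key : ∀ {I J : Ideal A} [I.IsTwoSided] [J.IsTwoSided], IsSimpleRing (A ⧸ I) →
      J ≤ I ∨ I ⊔ J = ⊤ := by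
    intro I J _ _ h
    have hs := (isSimpleRing_iff_isTwoSided_imp.1 h).2
      (J.map (Ideal.Quotient.mk I)) inferInstance
    refine hs.imp (fun h0 ↦ ?_) fun h1 ↦ ?_
    · rwa [Ideal.map_eq_bot_iff_le_ker, Ideal.mk_ker] at h0
    · have := congrArg (Ideal.comap (Ideal.Quotient.mk I)) h1
      rw [Ideal.comap_map_of_surjective' _ Ideal.Quotient.mk_surjective, Ideal.mk_ker,
        Ideal.comap_top] at this
      rwa [sup_comm]
  rcases key (J := J) hI with h1 | h1
  · rcases key (J := I) hJ with h2 | h2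
    · exact absurd (le_antisymm h2 h1) hne
    · rwa [sup_comm]
  · exact h1

/-- The column vectors over a division ring form a simple module for every ring mapping onto the
matrix ring. -/
theorem isSimpleModule_of_surjective_matrix {D : Type*} [DivisionRing D] {n : ℕ} (hn : 0 < n)
    [Module A (Fin n → D)] (f : A →+* Matrix (Fin n) (Fin n) D) (hf : Function.Surjective f)
    (h : ∀ a (x : Fin n → D), a • x = (f a).mulVec x) : IsSimpleModule A (Fin n → D) := by
  have : Nonempty (Fin n) := ⟨⟨0, hn⟩⟩
  refine isSimpleModule_iff_toSpanSingleton_surjective.2 ⟨inferInstance, fun x hx y ↦ ?_⟩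
  obtain ⟨j, hj⟩ := Function.ne_iff.1 hx
  -- The matrix supported in column `j` with entries `y r * (x j)⁻¹` carries `x` to `y`.
  obtain ⟨a, ha⟩ := hf (Matrix.of fun r s ↦ if s = j then y r * (x j)⁻¹ else 0)
  refine ⟨a, ?_⟩
  ext r
  have hj : x j ≠ 0 := hj
  simp [h, ha, Matrix.mulVec, dotProduct, hj]

end Rings

/-! ### Topological isomorphisms and products of discrete spaces -/

section Topological

variable (k : Type u) {A : Type v} [Field k] [Ring A] [Algebra k A] [TopologicalSpace A]

theorem exists_isTwoSided_le [IsPseudocompactAlgebra k A] {V : Ideal A}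
    (hV : IsOpen (V : Set A)) : ∃ I : Ideal A, I.IsTwoSided ∧ IsOpen (I : Set A) ∧ I ≤ V := by
  obtain ⟨I, h1, h2, -, h3⟩ := IsPseudocompactAlgebra.exists_ideal (k := k) (V : Set A)
    (hV.mem_nhds V.zero_mem)
  exact ⟨I, h1, h2, h3⟩

/-- A bijective continuous homomorphism of topological algebras is an isomorphism if the images of
open left ideals are neighbourhoods of zero. -/
theorem nonempty_continuousAlgEquiv [IsPseudocompactAlgebra k A] {B : Type*} [Ring B]
    [Algebra k B] [TopologicalSpace B] [IsTopologicalRing B] (f : A →ₐ[k] B)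
    (hf : Function.Bijective f) (hc : Continuous f)
    (ho : ∀ V : Ideal A, IsOpen (V : Set A) → ∃ s ∈ 𝓝 (0 : B), ∀ a, f a ∈ s → a ∈ V) :
    Nonempty (A ≃A[k] B) := by
  have : IsTopologicalRing A := IsPseudocompactAlgebra.toIsTopologicalRing k
  let e := AlgEquiv.ofBijective f hf
  have he : Continuous e.symm := by
    refine continuous_of_continuousAt_zero e.symm fun t ht ↦ ?_
    rw [map_zero] at ht
    obtain ⟨V, -, hV, -, hVt⟩ := IsPseudocompactAlgebra.exists_ideal (k := k) t ht
    obtain ⟨s, hs, hsV⟩ := ho V hV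
    refine Filter.mem_map.2 (Filter.mem_of_superset hs fun b hb ↦ hVt (hsV _ ?_))
    rwa [show f (e.symm b) = b from e.apply_symm_apply b]
  exact ⟨{ e with continuous_toFun := hc, continuous_invFun := he }⟩

/-- A product of discrete finite-dimensional vector spaces is pseudocompact. -/
theorem isPseudocompactModule_pi [TopologicalSpace k] [DiscreteTopology k] {ι : Type*}
    (B : ι → Type*) [∀ i, AddCommGroup (B i)] [∀ i, Module k (B i)]
    [∀ i, FiniteDimensional k (B i)] [∀ i, TopologicalSpace (B i)]
    [∀ i, DiscreteTopology (B i)] : IsPseudocompactModule k k (∀ i, B i) := by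
  have : ∀ i, ContinuousSMul k (B i) := fun i ↦ ⟨continuous_of_discreteTopology⟩
  refine { exists_submodule := fun s hs ↦ ?_, complete := ?_ }
  · rw [nhds_pi, Filter.mem_pi'] at hs
    obtain ⟨F, t, ht, hts⟩ := hs
    refine ⟨⨅ i ∈ F, (LinearMap.proj i : (∀ i, B i) →ₗ[k] B i).ker, ?_, ?_, fun x hx ↦ hts ?_⟩
    · simp only [Submodule.coe_iInf]
      exact isOpen_biInter_finset fun i _ ↦ (isOpen_discrete {0}).preimage (continuous_apply i)
    · let g : (∀ i, B i) →ₗ[k] ∀ i : F, B i := LinearMap.pi fun i ↦ LinearMap.proj i.1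
      have hg : g.ker = ⨅ i ∈ F, (LinearMap.proj i : (∀ i, B i) →ₗ[k] B i).ker := by
        ext x
        simp [g, funext_iff]
      rw [← hg]
      exact Module.Finite.of_injective (g.ker.liftQ g le_rfl)
        (LinearMap.ker_eq_bot.1 (Submodule.ker_liftQ_eq_bot _ _ _ le_rfl))
    · intro i hi
      simp only [Submodule.coe_iInf, Set.mem_iInter] at hx
      have : x i = 0 := hx i hi
      rw [this]
      exact mem_of_mem_nhds (ht i)
  · let _ : ∀ i, UniformSpace (B i) := fun i ↦ IsTopologicalAddGroup.rightUniformSpace (B i)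
    have : ∀ i, IsUniformAddGroup (B i) := fun i ↦ isUniformAddGroup_of_addCommGroup
    have : ∀ i, CompleteSpace (B i) := fun i ↦
      IsRightUniformAddGroup.completeSpace_of_weaklyLocallyCompactSpace
    rw [IsUniformAddGroup.rightUniformSpace_eq]
    infer_instance

end Topological

/-! ### Inverse limits of finite-dimensional algebras -/

section InverseLimit

/-- The open two-sided ideals of a topological ring, ordered by reverse inclusion. -/
structure OpenTwoSidedIdeal (A : Type v) [Ring A] [TopologicalSpace A] where
  toIdeal : Ideal A
  [isTwoSided : toIdeal.IsTwoSided]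
  isOpen : IsOpen (toIdeal : Set A)

attribute [instance] OpenTwoSidedIdeal.isTwoSided

instance (A : Type v) [Ring A] [TopologicalSpace A] : Preorder (OpenTwoSidedIdeal A) where
  le I J := J.toIdeal ≤ I.toIdeal
  le_refl I := le_refl I.toIdeal
  le_trans _ _ _ h₁ h₂ := h₂.trans h₁

instance (A : Type v) [Ring A] [TopologicalSpace A] : IsDirectedOrder (OpenTwoSidedIdeal A) where
  directed I J :=
    have : (I.toIdeal ⊓ J.toIdeal).IsTwoSided :=
      ⟨fun b h ↦ ⟨I.toIdeal.mul_mem_right b h.1, J.toIdeal.mul_mem_right b h.2⟩⟩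
    ⟨⟨I.toIdeal ⊓ J.toIdeal, I.isOpen.inter J.isOpen⟩, inf_le_left (a := I.toIdeal),
      inf_le_right (a := I.toIdeal)⟩

instance (A : Type v) [Ring A] [TopologicalSpace A] : Nonempty (OpenTwoSidedIdeal A) :=
  ⟨⟨⊤, isOpen_univ⟩⟩

variable (k : Type u) (A : Type v) [Field k] [Ring A] [Algebra k A] [TopologicalSpace A]
  [IsPseudocompactAlgebra k A]

/-- The inverse system of the quotients of `A` by its open two-sided ideals. -/
def quotientSystem : FinDimInverseSystem.{u, v} k where
  ι := OpenTwoSidedIdeal A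
  B I := A ⧸ I.toIdeal
  finiteDimensional I := finiteDimensional_quotient_of_isOpen k I.toIdeal I.isOpen
  topology _ := inferInstance
  discrete I :=
    have : IsTopologicalRing A := IsPseudocompactAlgebra.toIsTopologicalRing k
    QuotientAddGroup.discreteTopology (N := I.toIdeal.toAddSubgroup) I.isOpen
  φ I J h := Ideal.Quotient.factorₐ k (show J.toIdeal ≤ I.toIdeal from h)
  φ_self I := AlgHom.ext fun x ↦ by
    obtain ⟨x, rfl⟩ := Ideal.Quotient.mk_surjective x
    rfl
  φ_comp I J L hIJ hJL := AlgHom.ext fun x ↦ by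
    obtain ⟨x, rfl⟩ := Ideal.Quotient.mk_surjective x
    rfl

variable {k A}

namespace FinDimInverseSystem

variable (X : FinDimInverseSystem.{u, v} k)

theorem map_map {i j l : X.ι} (hij : i ≤ j) (hjl : j ≤ l) (x : X.B l) :
    X.φ hij (X.φ hjl x) = X.φ (hij.trans hjl) x :=
  AlgHom.congr_fun (X.φ_comp hij hjl) x

/-- An element of a stage of an inverse system that lifts to all later stages lifts to the
limit. -/
theorem exists_mem_limit {j : X.ι} (b : X.B j)
    (hb : ∀ l (h : j ≤ l), b ∈ (X.φ h).range) : ∃ x ∈ X.limit, x j = b := by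
  classical
  let _ : TopologicalSpace k := ⊥
  have : DiscreteTopology k := ⟨rfl⟩
  have := isPseudocompactModule_pi k X.B
  -- `N l` is the direction of the affine space of families that take the value `b` at `j` and are
  -- compatible below `l`. The point `c l` of that space comes from a lift of `b` to stage `l`, with
  -- the irrelevant coordinates set to zero.
  let N : {l // j ≤ l} → Submodule k (∀ i, X.B i) := fun l ↦
    { carrier := {x | x j = 0 ∧ ∀ i (h : i ≤ l.1), x i = X.φ h (x l.1)}
      zero_mem' := by simp
      add_mem' := fun hx hy ↦ ⟨by simp [hx.1, hy.1], fun i h ↦ by simp [hx.2 i h, hy.2 i h]⟩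
      smul_mem' := fun c x hx ↦ ⟨by simp [hx.1], fun i h ↦ by simp [hx.2 i h]⟩ }
  have hN : ∀ l, IsClosed (N l : Set (∀ i, X.B i)) := fun l ↦ by
    have : IsClosed {x : ∀ i, X.B i | ∀ i (h : i ≤ l.1), x i = X.φ h (x l.1)} := by
      simp only [Set.ofPred_forall]
      exact isClosed_iInter fun i ↦ isClosed_iInter fun h ↦ isClosed_eq (continuous_apply i)
        ((continuous_of_discreteTopology (f := X.φ h)).comp (continuous_apply l.1))
    exact (isClosed_eq (continuous_apply j) continuous_const).inter this
  have hc : ∀ l : {l // j ≤ l}, ∃ x : ∀ i, X.B i,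
      x j = b ∧ ∀ i (h : i ≤ l.1), x i = X.φ h (x l.1) := by
    intro l
    obtain ⟨y, rfl⟩ := hb l.1 l.2
    refine ⟨fun i ↦ if h : i ≤ l.1 then X.φ h y else 0, dif_pos l.2, fun i h ↦ ?_⟩
    simp [h, map_map]
  choose c hcj hc using hc
  obtain ⟨x, hx⟩ := exists_forall_sub_mem k (A := k) c N hN fun t ↦ by
    obtain ⟨m, hm⟩ := (insert j (t.image Subtype.val)).exists_le
    have hjm : j ≤ m := hm j (Finset.mem_insert_self _ _)
    refine ⟨c ⟨m, hjm⟩, fun l hl ↦ ?_⟩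
    have hlm : l.1 ≤ m := hm l (Finset.mem_insert_of_mem (Finset.mem_image_of_mem _ hl))
    refine ⟨by simp [hcj], fun i h ↦ ?_⟩
    simp only [Pi.sub_apply, map_sub, ← hc l i h]
    rw [hc ⟨m, hjm⟩ i (h.trans hlm), hc ⟨m, hjm⟩ l.1 hlm, map_map]
  have hxl : ∀ l (hl : j ≤ l) i (h : i ≤ l), x i = X.φ h (x l) := by
    intro l hl i h
    have := (hx ⟨l, hl⟩).2 i h
    simp only [Pi.sub_apply, map_sub, ← hc ⟨l, hl⟩ i h] at this
    exact sub_left_inj.1 this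
  refine ⟨x, fun i i' h ↦ ?_, ?_⟩
  · obtain ⟨l, hjl, hl⟩ := exists_ge_ge j i'
    rw [hxl l hjl i' hl, hxl l hjl i (h.trans hl), map_map]
  · have := (hx ⟨j, le_refl j⟩).1
    simpa [hcj, sub_eq_zero] using this

/-- A pseudocompact algebra with a compatible family of surjections with open kernels, forming a
basis of neighbourhoods of zero, is the inverse limit. -/
theorem nonempty_continuousAlgEquiv_limit (q : ∀ i, A →ₐ[k] X.B i)
    (hqs : ∀ i, Function.Surjective (q i))
    (hqm : ∀ ⦃i j⦄ (h : i ≤ j) a, X.φ h (q j a) = q i a)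
    (hqo : ∀ i, IsOpen (RingHom.ker (q i) : Set A))
    (hqb : ∀ V : Ideal A, IsOpen (V : Set A) → ∃ i, RingHom.ker (q i) ≤ V) :
    Nonempty (A ≃A[k] X.limit) := by
  have hT : T2Space A := IsPseudocompactAlgebra.toT2Space k
  have hR : IsTopologicalRing A := IsPseudocompactAlgebra.toIsTopologicalRing k
  have hL : IsTopologicalRing X.limit := inferInstanceAs (IsTopologicalRing X.limit.toSubring)
  let f : A →ₐ[k] X.limit := (AlgHom.pi q).codRestrict _ fun a i j h ↦ hqm h a
  refine nonempty_continuousAlgEquiv k f ⟨?_, ?_⟩ ?_ ?_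
  · refine (injective_iff_map_eq_zero f).2 fun a ha ↦ ?_
    by_contra h0
    obtain ⟨V, hV, haV⟩ := exists_isOpen_notMem k (A := A) h0
    obtain ⟨i, hi⟩ := hqb V hV
    exact haV (hi (congrFun (congrArg Subtype.val ha) i))
  · intro y
    choose c hc using fun i ↦ hqs i (y.1 i)
    obtain ⟨x, hx⟩ := exists_forall_sub_mem k (A := A) c (fun i ↦ RingHom.ker (q i))
      (fun i ↦ isClosed_of_isOpen k (hqo i)) fun t ↦ by
        obtain ⟨j, hj⟩ := t.exists_le
        refine ⟨c j, fun i hi ↦ ?_⟩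
        rw [RingHom.mem_ker, map_sub, hc, ← hqm (hj i hi), hc, y.2 (hj i hi), sub_self]
    refine ⟨x, Subtype.ext (funext fun i ↦ ?_)⟩
    have := hx i
    rw [RingHom.mem_ker, map_sub, hc, sub_eq_zero] at this
    exact this
  · refine Continuous.subtype_mk (continuous_pi fun i ↦ ?_) _
    refine continuous_of_continuousAt_zero (q i) fun s hs ↦ ?_
    rw [map_zero] at hs
    refine Filter.mem_map.2 (Filter.mem_of_superset
      ((hqo i).mem_nhds (zero_mem _)) fun a ha ↦ ?_)
    rw [Set.mem_preimage, show q i a = 0 from ha]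
    exact mem_of_mem_nhds hs
  · intro V hV
    obtain ⟨i, hi⟩ := hqb V hV
    have hp : Continuous fun y : X.limit ↦ y.1 i :=
      (continuous_apply _).comp continuous_subtype_val
    exact ⟨_, ((isOpen_discrete {0}).preimage hp).mem_nhds rfl, fun a ha ↦ hi ha⟩

end FinDimInverseSystem

variable (k) in
theorem HasSemisimpleQuotients.isInverseLimitOfSemisimple (hA : HasSemisimpleQuotients A) :
    IsInverseLimitOfSemisimple k A := by
  refine ⟨quotientSystem k A, fun I : OpenTwoSidedIdeal A ↦ ?_,
    (quotientSystem k A).nonempty_continuousAlgEquiv_limit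
      (fun I : OpenTwoSidedIdeal A ↦ Ideal.Quotient.mkₐ k I.toIdeal)
      (fun I : OpenTwoSidedIdeal A ↦ Ideal.Quotient.mk_surjective) (fun _ _ _ _ ↦ rfl)
      (fun I : OpenTwoSidedIdeal A ↦ ?_) fun V hV ↦ ?_⟩
  · have := hA I.toIdeal I.isOpen
    exact isSemisimpleRing_quotient I.toIdeal
  · convert I.isOpen
    exact Ideal.mk_ker
  · obtain ⟨I, h1, h2, h3⟩ := exists_isTwoSided_le k hV
    exact ⟨(⟨I, h2⟩ : OpenTwoSidedIdeal A), Ideal.mk_ker.le.trans h3⟩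

omit [IsPseudocompactAlgebra k A] in
-- The transition maps need not be surjective, so `A` need not map onto `X.B j`. By finite dimension
-- the images of later stages in `X.B j` reach a smallest one, `R`. It is semisimple as a quotient
-- of some `X.B l`, and `A` maps onto it because its elements lift to all later stages.
theorem IsInverseLimitOfSemisimple.hasSemisimpleQuotients (h : IsInverseLimitOfSemisimple k A) :
    HasSemisimpleQuotients A := by
  classical
  obtain ⟨X, hX, ⟨e⟩⟩ := h
  intro V hV
  have hs : ∃ j, ∀ a, (e a).1 j = 0 → a ∈ V := by
    have h0 : e.symm ⁻¹' (V : Set A) ∈ 𝓝 (0 : X.limit) :=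
      (hV.preimage e.symm.continuous).mem_nhds (by simp)
    rw [nhds_subtype, Filter.mem_comap] at h0
    obtain ⟨s, hs, hsV⟩ := h0
    rw [nhds_pi, Filter.mem_pi'] at hs
    obtain ⟨F, t, ht, hts⟩ := hs
    obtain ⟨j, hj⟩ := F.exists_le
    refine ⟨j, fun a ha ↦ ?_⟩
    have : e a ∈ e.symm ⁻¹' (V : Set A) := hsV (hts fun i hi ↦ by
      have h1 : (e a).1 i = 0 := by rw [← (e a).2 (hj i hi), ha, map_zero]
      rw [h1]
      exact mem_of_mem_nhds (ht i))
    simpa using this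
  obtain ⟨j, hj⟩ := hs
  obtain ⟨_, ⟨l, rfl⟩, hmin⟩ := IsWellFounded.wf (r := (· < · : Submodule k (X.B j) → _))
    |>.has_min (Set.range fun l : {l // j ≤ l} ↦ (X.φ l.2).toLinearMap.range)
    ⟨_, ⟨j, le_refl j⟩, rfl⟩
  let R := (X.φ l.2).range
  have hR : IsSemisimpleRing R := RingHom.isSemisimpleRing_of_surjective
    (X.φ l.2).rangeRestrict.toRingHom (X.φ l.2).rangeRestrict_surjective
  have hrange : ∀ b ∈ R, ∀ m (h : j ≤ m), b ∈ (X.φ h).range := by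
    intro b hb m h
    obtain ⟨n, hln, hmn⟩ := exists_ge_ge l.1 m
    have hle : (X.φ (h.trans hmn)).toLinearMap.range ≤ (X.φ l.2).toLinearMap.range := by
      rintro _ ⟨y, rfl⟩
      exact ⟨X.φ hln y, X.map_map _ _ _⟩
    obtain ⟨y, rfl⟩ := (hle.eq_of_not_lt (hmin _ ⟨⟨n, h.trans hmn⟩, rfl⟩)).ge hb
    exact ⟨X.φ hmn y, X.map_map _ _ _⟩
  let p : A →ₐ[k] R := (((Pi.evalAlgHom k X.B j).comp X.limit.val).comp
    (e : A →ₐ[k] X.limit)).codRestrict R fun a ↦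
      ⟨(e a).1 l.1, (e a).2 l.2⟩
  have hp : Function.Surjective p := by
    rintro ⟨b, hb⟩
    obtain ⟨x, hx, rfl⟩ := X.exists_mem_limit b (hrange b hb)
    obtain ⟨a, ha⟩ := e.surjective ⟨x, hx⟩
    refine ⟨a, Subtype.ext ?_⟩
    change (e a).1 j = x j
    rw [ha]
  have := isSemisimpleModule_quotient_ker p.toRingHom hp
  have hle : RingHom.ker p.toRingHom ≤ V := fun a ha ↦ hj a (congrArg Subtype.val ha)
  exact IsSemisimpleModule.of_surjective (Submodule.factor hle) (Submodule.factor_surjective hle)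

end InverseLimit

/-! ### Decomposition into matrix algebras -/

section Product

variable (k : Type u) {A : Type v} [Field k] [Ring A] [Algebra k A] [TopologicalSpace A]
  [IsPseudocompactAlgebra k A]

/-- The open two-sided ideals with simple quotient ring. -/
structure OpenSimpleIdeal (A : Type v) [Ring A] [TopologicalSpace A] extends
    OpenTwoSidedIdeal A where
  [isSimpleRing : IsSimpleRing (A ⧸ toIdeal)]

attribute [instance] OpenSimpleIdeal.isSimpleRing

omit [Algebra k A] [IsPseudocompactAlgebra k A] [Field k] in
theorem OpenSimpleIdeal.ext {I J : OpenSimpleIdeal A} (h : I.toIdeal = J.toIdeal) : I = J := by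
  obtain ⟨⟨I, _⟩⟩ := I
  obtain ⟨⟨J, _⟩⟩ := J
  obtain rfl : I = J := h
  rfl

include k in
-- For an open two-sided `J`, the ring `A ⧸ J` is a finite product of matrix rings, and the kernel
-- of each coordinate of `A` in it is an open ideal with simple quotient. An element of all such
-- ideals therefore lies in `J`.
theorem HasSemisimpleQuotients.iInf_openSimpleIdeal (hA : HasSemisimpleQuotients A) :
    ⨅ I : OpenSimpleIdeal A, I.toIdeal = ⊥ := by
  have : T2Space A := IsPseudocompactAlgebra.toT2Space k
  refine (Submodule.eq_bot_iff _).2 fun x hx ↦ ?_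
  rw [Submodule.mem_iInf] at hx
  by_contra h0
  obtain ⟨V, hV, hxV⟩ := exists_isOpen_notMem k (A := A) h0
  obtain ⟨J, _, hJ, hJV⟩ := exists_isTwoSided_le k hV
  have := hA J hJ
  have := isSemisimpleRing_quotient J
  obtain ⟨n, D, d, _, hd, ⟨e⟩⟩ :=
    IsSemisimpleRing.exists_ringEquiv_pi_matrix_divisionRing (A ⧸ J)
  refine hxV (hJV (Ideal.Quotient.eq_zero_iff_mem.1 ((map_eq_zero_iff e e.injective).1 ?_)))
  funext i
  let p : A →+* Matrix (Fin (d i)) (Fin (d i)) (D i) :=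
    ((Pi.evalRingHom _ i).comp e.toRingHom).comp (Ideal.Quotient.mk J)
  have hp : Function.Surjective p :=
    ((Function.surjective_eval i).comp e.surjective).comp Ideal.Quotient.mk_surjective
  have hle : J ≤ RingHom.ker p := fun a ha ↦ by
    simp [RingHom.mem_ker, p, Ideal.Quotient.eq_zero_iff_mem.2 ha]
  have : IsSimpleRing (A ⧸ RingHom.ker p) :=
    .of_ringEquiv (RingHom.quotientKerEquivOfSurjective hp).symm inferInstance
  exact hx ⟨⟨RingHom.ker p, isOpen_of_le k hle hJ⟩⟩

/-- A pseudocompact algebra with a separating family of pairwise coprime surjections with open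
kernels is the product of the targets. -/
theorem nonempty_continuousAlgEquiv_pi {ι : Type*} {R : ι → Type*} [∀ i, Ring (R i)]
    [∀ i, Algebra k (R i)] [∀ i, TopologicalSpace (R i)] [∀ i, DiscreteTopology (R i)]
    (q : ∀ i, A →ₐ[k] R i) (hqs : ∀ i, Function.Surjective (q i))
    (hqo : ∀ i, IsOpen (RingHom.ker (q i) : Set A))
    (hpair : Pairwise fun i j ↦ RingHom.ker (q i) ⊔ RingHom.ker (q j) = ⊤)
    (hbot : ⨅ i, RingHom.ker (q i) = ⊥) : Nonempty (A ≃A[k] ∀ i, R i) := by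
  have hR : IsTopologicalRing A := IsPseudocompactAlgebra.toIsTopologicalRing k
  refine nonempty_continuousAlgEquiv k (AlgHom.pi q) ⟨?_, ?_⟩ ?_ ?_
  · refine (injective_iff_map_eq_zero (AlgHom.pi q)).2 fun a ha ↦ ?_
    rw [← Submodule.mem_bot A, ← hbot, Submodule.mem_iInf]
    exact fun i ↦ congrFun ha i
  · intro y
    choose c hc using fun i ↦ hqs i (y i)
    -- The Chinese remainder theorem solves any finite set of congruences; linear compactness solves
    -- them all at once.
    obtain ⟨x, hx⟩ := exists_forall_sub_mem k (A := A) c (fun i ↦ RingHom.ker (q i))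
      (fun i ↦ isClosed_of_isOpen k (hqo i)) (exists_forall_sub_mem_of_sup_eq_top _ hpair c)
    refine ⟨x, funext fun i ↦ ?_⟩
    have := hx i
    rw [RingHom.mem_ker, map_sub, hc, sub_eq_zero] at this
    exact this
  · refine continuous_pi fun i ↦ ?_
    refine continuous_of_continuousAt_zero (q i) fun s hs ↦ ?_
    rw [map_zero] at hs
    refine Filter.mem_map.2 (Filter.mem_of_superset
      ((hqo i).mem_nhds (zero_mem _)) fun a ha ↦ ?_)
    rw [Set.mem_preimage, show q i a = 0 from ha]
    exact mem_of_mem_nhds hs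
  · intro V hV
    obtain ⟨t, ht⟩ := exists_finset_iInf_le k (fun i ↦ RingHom.ker (q i))
      (fun i ↦ isClosed_of_isOpen k (hqo i)) hV (hbot.le.trans bot_le)
    refine ⟨⋂ i ∈ t, (fun y : ∀ i, R i ↦ y i) ⁻¹' {0},
      (isOpen_biInter_finset fun i _ ↦
        (isOpen_discrete {0}).preimage (continuous_apply i)).mem_nhds (by simp),
      fun a ha ↦ ht ?_⟩
    simp only [Submodule.mem_iInf]
    exact fun i hi ↦ Set.mem_iInter₂.1 ha i hi

instance DivisionFamily.discreteTopology_matrix (F : DivisionFamily.{u, w} k) (i : F.ι) :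
    DiscreteTopology (Matrix (Fin (F.n i)) (Fin (F.n i)) (F.D i)) :=
  inferInstanceAs (DiscreteTopology (Fin (F.n i) → Fin (F.n i) → F.D i))

theorem DivisionFamily.nonempty_continuousAlgEquiv (F : DivisionFamily.{u, w} k)
    (q : ∀ i, A →ₐ[k] Matrix (Fin (F.n i)) (Fin (F.n i)) (F.D i))
    (hqs : ∀ i, Function.Surjective (q i)) (hqo : ∀ i, IsOpen (RingHom.ker (q i) : Set A))
    (hpair : Pairwise fun i j ↦ RingHom.ker (q i) ⊔ RingHom.ker (q j) = ⊤)
    (hbot : ⨅ i, RingHom.ker (q i) = ⊥) : Nonempty (A ≃A[k] F.MatrixProduct) :=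
  nonempty_continuousAlgEquiv_pi k q hqs hqo hpair hbot

theorem HasSemisimpleQuotients.exists_divisionFamily (hA : HasSemisimpleQuotients A) :
    ∃ F : DivisionFamily.{u, v} k, Nonempty (A ≃A[k] F.MatrixProduct) := by
  have hfin : ∀ I : OpenSimpleIdeal A, FiniteDimensional k (A ⧸ I.toIdeal) := fun I ↦
    finiteDimensional_quotient_of_isOpen k I.toIdeal I.isOpen
  have hart : ∀ I : OpenSimpleIdeal A, IsArtinianRing (A ⧸ I.toIdeal) := fun I ↦
    isArtinian_of_tower k inferInstance
  choose n hn D hD hD' hDf e using fun I : OpenSimpleIdeal A ↦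
    IsSimpleRing.exists_algEquiv_matrix_divisionRing_finite k (A ⧸ I.toIdeal)
  let F : DivisionFamily.{u, v} k :=
    { ι := OpenSimpleIdeal A
      n := n
      n_pos := fun I ↦ Nat.pos_of_ne_zero (hn I).out
      D := D
      topology := fun _ ↦ ⊥
      discrete := fun _ ↦ @DiscreteTopology.mk _ ⊥ rfl }
  let q : ∀ I : OpenSimpleIdeal A, A →ₐ[k] Matrix (Fin (n I)) (Fin (n I)) (D I) := fun I ↦
    (e I).some.toAlgHom.comp (Ideal.Quotient.mkₐ k I.toIdeal)
  have hq : ∀ I : OpenSimpleIdeal A, RingHom.ker (q I) = I.toIdeal := fun I ↦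
    Ideal.ext fun a ↦ (map_eq_zero_iff (e I).some (e I).some.injective).trans
      Ideal.Quotient.eq_zero_iff_mem
  refine ⟨F, F.nonempty_continuousAlgEquiv k q
    (fun I ↦ (e I).some.surjective.comp Ideal.Quotient.mk_surjective) (fun I ↦ ?_)
    (fun I J h ↦ ?_) ?_⟩
  · exact (hq I).symm ▸ OpenTwoSidedIdeal.isOpen _
  · have := sup_eq_top_of_isSimpleRing_quotient fun h' ↦ h (OpenSimpleIdeal.ext h')
    rwa [← hq I, ← hq J] at this
  · exact (iInf_congr hq).trans (hA.iInf_openSimpleIdeal k)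

theorem isProductOfSimples_of_divisionFamily (F : DivisionFamily.{u, v} k)
    (e : A ≃A[k] F.MatrixProduct) : IsProductOfSimples k A := by
  have hR : IsTopologicalRing A := IsPseudocompactAlgebra.toIsTopologicalRing k
  let q : ∀ i, A →ₐ[k] Matrix (Fin (F.n i)) (Fin (F.n i)) (F.D i) := fun i ↦
    (Pi.evalAlgHom k _ i).comp (e : A →ₐ[k] F.MatrixProduct)
  have hqs : ∀ i, Function.Surjective (q i) := fun i ↦
    (Function.surjective_eval i).comp e.surjective
  have hqc : ∀ i, Continuous (q i) := fun i ↦ (continuous_apply i).comp e.continuous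
  -- One simple module for each column of each matrix factor, with `A` acting through that factor.
  let S : (Σ i, Fin (F.n i)) → Type v := fun s ↦ Fin (F.n s.1) → F.D s.1
  let _ : ∀ s, AddCommGroup (S s) := fun s ↦ inferInstanceAs (AddCommGroup (Fin _ → F.D s.1))
  let _ : ∀ s, Module k (S s) := fun s ↦ inferInstanceAs (Module k (Fin _ → F.D s.1))
  let _ : ∀ s, TopologicalSpace (S s) := fun s ↦
    inferInstanceAs (TopologicalSpace (Fin _ → F.D s.1))
  let _ : ∀ s, Module A (S s) := fun s ↦
    Module.compHom (Fin (F.n s.1) → F.D s.1) (q s.1).toRingHom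
  have hsmul : ∀ s a (x : S s), a • x = (q s.1 a).mulVec x := fun _ _ _ ↦ rfl
  have hst : ∀ s, IsScalarTower k A (S s) := fun s ↦ ⟨fun c a x ↦ by
    rw [hsmul, hsmul, map_smul]
    exact Matrix.smul_mulVec c (q s.1 a) x⟩
  refine ⟨_, S, inferInstance, inferInstance, inferInstance, hst, inferInstance, fun s ↦ ?_, ?_⟩
  · have hd : DiscreteTopology (S s) := inferInstanceAs (DiscreteTopology (Fin _ → F.D s.1))
    have hf : FiniteDimensional k (S s) :=
      inferInstanceAs (FiniteDimensional k (Fin (F.n s.1) → F.D s.1))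
    have hs : IsSimpleModule A (S s) := isSimpleModule_of_surjective_matrix (F.n_pos s.1)
      (q s.1).toRingHom (hqs s.1) (hsmul s)
    have hcs : ContinuousSMul A (S s) := continuousSMul_of_discreteTopology fun x ↦
      (isOpen_discrete {M : Matrix (Fin (F.n s.1)) (Fin (F.n s.1)) (F.D s.1) |
        M.mulVec x = 0}).preimage (hqc s.1)
    exact { isPseudocompactModule_of_discreteTopology k with
      toNontrivial := IsSimpleModule.nontrivial A (S s)
      eq_bot_or_eq_top := fun N _ ↦ eq_bot_or_eq_top N }
  · refine ⟨{
      toFun := fun a s r ↦ e a s.1 r s.2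
      map_add' := fun a b ↦ by
        funext s r
        rw [map_add]
        rfl
      map_smul' := fun a b ↦ by
        funext s r
        exact congrFun (congrFun (congrFun (map_mul e a b) s.1) r) s.2
      invFun := fun y ↦ e.symm fun i ↦ Matrix.of fun r c ↦ y ⟨i, c⟩ r
      left_inv := fun a ↦ e.symm_apply_apply a
      right_inv := fun y ↦ by
        funext s r
        simp
      continuous_toFun := ?_
      continuous_invFun := ?_ }⟩
    · exact continuous_pi fun s ↦ continuous_pi fun r ↦ (continuous_apply s.2).comp
        ((continuous_apply r).comp ((continuous_apply s.1).comp e.continuous))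
    · exact e.symm.continuous.comp (continuous_pi fun i ↦ continuous_pi fun r ↦
        continuous_pi fun c ↦ (continuous_apply r).comp
          (continuous_apply (⟨i, c⟩ : Σ i, Fin (F.n i))))

end Product

/-! ### Uniqueness of the simple factors -/

section CentralIdempotents

/-- The centre of a simple ring is a field, whose only idempotents are `0` and `1`. -/
theorem eq_zero_or_one_of_isIdempotentElem_of_mem_center {R : Type*} [Ring R] [IsSimpleRing R]
    {c : R} (hc : IsIdempotentElem c) (hcent : ∀ x, c * x = x * c) : c = 0 ∨ c = 1 := by
  let _ := (IsSimpleRing.isField_center R).toField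
  let z : Subring.center R := ⟨c, Subring.mem_center_iff.2 fun x ↦ (hcent x).symm⟩
  have hz : IsIdempotentElem z := Subtype.ext hc
  refine (IsIdempotentElem.iff_eq_zero_or_one.1 hz).imp (congrArg Subtype.val)
    (congrArg Subtype.val)

variable {k : Type*} [CommRing k] {ι : Type*} {κ : Type*} {R : ι → Type*} {S : κ → Type*}
  [∀ i, Ring (R i)] [∀ i, Algebra k (R i)] [∀ j, Ring (S j)] [∀ j, Algebra k (S j)]
  [∀ i, IsSimpleRing (R i)] [∀ j, IsSimpleRing (S j)] [DecidableEq ι] [DecidableEq κ]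

omit [∀ i, IsSimpleRing (R i)] [DecidableEq κ] in
theorem map_single_one_apply_eq_zero_or_one (e : (∀ i, R i) ≃+* ∀ j, S j) (i : ι) (j : κ) :
    e (Pi.single i 1) j = 0 ∨ e (Pi.single i 1) j = 1 := by
  classical
  refine eq_zero_or_one_of_isIdempotentElem_of_mem_center ?_ fun x ↦ ?_
  · rw [IsIdempotentElem, ← Pi.mul_apply, ← map_mul, ← Pi.single_mul, one_mul]
  · have hc : ∀ y : ∀ i, R i, Pi.single i 1 * y = y * Pi.single i 1 := fun y ↦ by
      ext l
      rcases eq_or_ne l i with rfl | h <;> simp [*]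
    simpa using congrFun (congrArg e (hc (e.symm (Pi.single j x)))) j

theorem eq_of_single_one_eq {i i' : ι} (h : (Pi.single i 1 : ∀ i, R i) = Pi.single i' 1) :
    i = i' := by
  by_contra hne
  simpa [hne] using congrFun h i

/-- A ring isomorphism between products preserves the central idempotents cutting out the
factors. -/
theorem exists_map_single_one (e : (∀ i, R i) ≃+* ∀ j, S j) (i : ι) :
    ∃ j, e (Pi.single i 1) = Pi.single j 1 := by
  obtain ⟨j, hj⟩ : ∃ j, e (Pi.single i 1) j ≠ 0 := by
    by_contra! h
    have h0 : e (Pi.single i 1) = 0 := funext h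
    rw [map_eq_zero_iff e e.injective, Pi.single_eq_zero_iff] at h0
    exact one_ne_zero h0
  have hj1 := (map_single_one_apply_eq_zero_or_one e i j).resolve_left hj
  refine ⟨j, ?_⟩
  -- Since the image of the `i`-th idempotent is `1` at `j`, it fixes the `j`-th idempotent. So
  -- `e.symm (Pi.single j 1)` is supported at `i`, where it is `0` or `1`, and `0` is excluded by
  -- injectivity.
  have hd : e.symm (Pi.single j 1) * Pi.single i 1 = e.symm (Pi.single j 1) := by
    apply e.injective
    rw [map_mul, e.apply_symm_apply]
    ext l
    rcases eq_or_ne l j with rfl | h <;> simp [*]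
  have hd' : e.symm (Pi.single j 1) = Pi.single i (e.symm (Pi.single j 1) i) := by
    rw [← hd]
    ext l
    rcases eq_or_ne l i with rfl | h <;> simp [*]
  rcases map_single_one_apply_eq_zero_or_one e.symm j i with h | h
  · rw [h, Pi.single_zero, map_eq_zero_iff e.symm e.symm.injective, Pi.single_eq_zero_iff] at hd'
    exact absurd hd' one_ne_zero
  · rw [h] at hd'
    rw [← hd', e.apply_symm_apply]

theorem nonempty_algEquiv_of_map_single_one (e : (∀ i, R i) ≃ₐ[k] ∀ j, S j) {i : ι} {j : κ}
    (h : e (Pi.single i 1) = Pi.single j 1) : Nonempty (R i ≃ₐ[k] S j) := by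
  let f : R i →ₐ[k] S j := AlgHom.ofLinearMap
    (LinearMap.proj j ∘ₗ e.toLinearMap ∘ₗ LinearMap.single k R i) (by simp [h])
    (fun x y ↦ by simp [Pi.single_mul])
  refine ⟨AlgEquiv.ofBijective f ⟨f.toRingHom.injective, fun y ↦
    ⟨e.symm (Pi.single j y) i, ?_⟩⟩⟩
  have : Pi.single i (e.symm (Pi.single j y) i) = Pi.single i 1 * e.symm (Pi.single j y) := by
    ext l
    rcases eq_or_ne l i with rfl | h <;> simp [*]
  change e (Pi.single i (e.symm (Pi.single j y) i)) j = y
  rw [this, map_mul, h, e.apply_symm_apply]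
  simp

/-- Isomorphic products of simple algebras have the same factors. -/
theorem exists_equiv_of_algEquiv_pi (e : (∀ i, R i) ≃ₐ[k] ∀ j, S j) :
    ∃ σ : ι ≃ κ, ∀ i, Nonempty (R i ≃ₐ[k] S (σ i)) := by
  choose σ hσ using exists_map_single_one e.toRingEquiv
  choose τ hτ using exists_map_single_one e.symm.toRingEquiv
  have hσ : ∀ i, e (Pi.single i 1) = Pi.single (σ i) 1 := hσ
  have hτ : ∀ j, e.symm (Pi.single j 1) = Pi.single (τ j) 1 := hτ
  exact ⟨⟨σ, τ, fun i ↦ eq_of_single_one_eq (R := R)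
    ((hτ (σ i)).symm.trans (e.symm_apply_eq.2 (hσ i).symm)),
    fun j ↦ eq_of_single_one_eq (R := S) ((hσ (τ j)).symm.trans (e.symm_apply_eq.1 (hτ j)).symm)⟩,
    fun i ↦ nonempty_algEquiv_of_map_single_one e (hσ i)⟩

end CentralIdempotents

/-! ### Uniqueness of the matrix size and the division algebra -/

section MatrixAlgebras

variable {k : Type u} [Field k] {D : Type w₁} {E : Type w₂} [DivisionRing D] [DivisionRing E]
  [Algebra k D] [Algebra k E]

/-- The endomorphisms of the column module are the right multiplications. -/
theorem nonempty_mulOpposite_algEquiv_end {R : Type*} [Ring R] [Algebra k R] {n : ℕ}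
    (hn : 0 < n) (f : R →ₐ[k] Matrix (Fin n) (Fin n) D) (hf : Function.Surjective f)
    [Module R (Fin n → D)] [IsScalarTower k R (Fin n → D)]
    (h : ∀ a (x : Fin n → D), a • x = (f a).mulVec x) :
    Nonempty (Dᵐᵒᵖ ≃ₐ[k] Module.End R (Fin n → D)) := by
  let i₀ : Fin n := ⟨0, hn⟩
  let ρ : Dᵐᵒᵖ →ₐ[k] Module.End R (Fin n → D) := AlgHom.ofLinearMap
    { toFun := fun d ↦
        { toFun := fun x i ↦ x i * d.unop
          map_add' := fun x y ↦ by ext; simp [add_mul]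
          map_smul' := fun a x ↦ by
            ext
            simp [h, Matrix.mulVec, dotProduct, Finset.sum_mul, mul_assoc] }
      map_add' := fun d d' ↦ by ext; simp [mul_add]
      map_smul' := fun c d ↦ by ext; simp }
    (by ext; simp) (fun d d' ↦ by ext; simp [mul_assoc])
  have hρ : ∀ d x i, ρ d x i = x i * d.unop := fun _ _ _ ↦ rfl
  refine ⟨AlgEquiv.ofBijective ρ ⟨fun d d' hd ↦ ?_, fun g ↦ ?_⟩⟩
  · have := congrFun (LinearMap.congr_fun hd (Pi.single i₀ 1)) i₀
    simpa [hρ] using this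
  · refine ⟨.op (g (Pi.single i₀ 1) i₀), LinearMap.ext fun x ↦ ?_⟩
    obtain ⟨a, ha⟩ := hf (Matrix.of fun r c ↦ if c = i₀ then x r else 0)
    have hx : a • (Pi.single i₀ 1 : Fin n → D) = x := by
      ext r
      simp [h, ha, Matrix.mulVec, dotProduct, Pi.single_apply]
    rw [← hx, map_smul, map_smul, h, h]
    ext r
    simp [ha, Matrix.mulVec, dotProduct, hρ]

/-- A simple artinian ring has only one simple module up to isomorphism, so the two column modules
agree over `R`. Comparing their endomorphism algebras identifies `D` with `E`, and comparing their
dimensions over `k` then gives `n = m`. -/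
theorem eq_and_nonempty_algEquiv_of_matrix_algEquiv [FiniteDimensional k D]
    [FiniteDimensional k E] {n m : ℕ} (hn : 0 < n) (hm : 0 < m)
    (e : Matrix (Fin n) (Fin n) D ≃ₐ[k] Matrix (Fin m) (Fin m) E) :
    n = m ∧ Nonempty (D ≃ₐ[k] E) := by
  have : Nonempty (Fin n) := ⟨⟨0, hn⟩⟩
  let R := Matrix (Fin n) (Fin n) D
  have hart : IsArtinianRing R := isArtinian_of_tower k inferInstance
  let _ : Module R (Fin m → E) := Module.compHom _ e.toRingEquiv.toRingHom
  have hV : ∀ (a : R) (x : Fin n → D), a • x = (AlgHom.id k R a).mulVec x := fun _ _ ↦ rfl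
  have hW : ∀ (a : R) (x : Fin m → E), a • x = (e.toAlgHom a).mulVec x := fun _ _ ↦ rfl
  have hWt : IsScalarTower k R (Fin m → E) := ⟨fun c a x ↦ by
    rw [hW, hW, map_smul]
    exact Matrix.smul_mulVec c (e a) x⟩
  have hVs : IsSimpleModule R (Fin n → D) :=
    isSimpleModule_of_surjective_matrix hn (RingHom.id R) Function.surjective_id hV
  have hWs : IsSimpleModule R (Fin m → E) :=
    isSimpleModule_of_surjective_matrix hm e.toAlgHom.toRingHom e.surjective hW
  obtain ⟨I, ⟨fI⟩⟩ := IsSemisimpleRing.exists_linearEquiv_ideal_of_isSimpleModule R (Fin n → D)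
  obtain ⟨J, ⟨fJ⟩⟩ := IsSemisimpleRing.exists_linearEquiv_ideal_of_isSimpleModule R (Fin m → E)
  have : IsSimpleModule R I := IsSimpleModule.congr fI.symm
  have : IsSimpleModule R J := IsSimpleModule.congr fJ.symm
  obtain ⟨fIJ⟩ := IsSimpleRing.isIsotypic R R J I
  let f : (Fin n → D) ≃ₗ[R] (Fin m → E) := (fI.trans fIJ).trans fJ.symm
  obtain ⟨eD⟩ := nonempty_mulOpposite_algEquiv_end (k := k) hn (AlgHom.id k R)
    Function.surjective_id hV
  obtain ⟨eE⟩ := nonempty_mulOpposite_algEquiv_end (k := k) hm e.toAlgHom e.surjective hW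
  let eDE : D ≃ₐ[k] E := AlgEquiv.op.symm ((eD.trans (f.conjAlgEquiv k)).trans eE.symm)
  refine ⟨?_, ⟨eDE⟩⟩
  have h1 := (f.restrictScalars k).finrank_eq
  rw [Module.finrank_pi_fintype, Module.finrank_pi_fintype] at h1
  simp only [Finset.sum_const, Finset.card_univ, Fintype.card_fin, smul_eq_mul,
    eDE.toLinearEquiv.finrank_eq] at h1
  exact Nat.eq_of_mul_eq_mul_right Module.finrank_pos h1

theorem DivisionFamily.exists_equiv {F : DivisionFamily.{u, w₁} k} {G : DivisionFamily.{u, w₂} k}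
    (e : F.MatrixProduct ≃ₐ[k] G.MatrixProduct) :
    ∃ σ : F.ι ≃ G.ι, ∀ i, F.n i = G.n (σ i) ∧ Nonempty (F.D i ≃ₐ[k] G.D (σ i)) := by
  classical
  have hF : ∀ i, Nonempty (Fin (F.n i)) := fun i ↦ ⟨⟨0, F.n_pos i⟩⟩
  have hG : ∀ j, Nonempty (Fin (G.n j)) := fun j ↦ ⟨⟨0, G.n_pos j⟩⟩
  obtain ⟨σ, hσ⟩ := exists_equiv_of_algEquiv_pi e
  refine ⟨σ, fun i ↦ ?_⟩
  obtain ⟨ei⟩ := hσ i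
  exact eq_and_nonempty_algEquiv_of_matrix_algEquiv (F.n_pos i) (G.n_pos _) ei

end MatrixAlgebras

end Pseudocompact

theorem mainTheorem4 (k : Type u) (A : Type v) [Field k] [Ring A] [Algebra k A]
    [TopologicalSpace A] [Pseudocompact.IsPseudocompactAlgebra k A] :
    List.TFAE [
      Pseudocompact.IsTopologicallySemisimple A,
      Pseudocompact.topJacobson A = ⊥,
      Pseudocompact.IsProductOfSimples k A,
      Pseudocompact.EveryModuleProjective k A,
      Pseudocompact.EveryModuleInjective k A,
      Pseudocompact.IsInverseLimitOfSemisimple k A,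
      ∃ F : Pseudocompact.DivisionFamily.{u, v} k, Nonempty (A ≃A[k] F.MatrixProduct)] ∧
    ∀ (F : Pseudocompact.DivisionFamily.{u, w₁} k) (G : Pseudocompact.DivisionFamily.{u, w₂} k),
      Nonempty (A ≃A[k] F.MatrixProduct) → Nonempty (A ≃A[k] G.MatrixProduct) →
      ∃ σ : F.ι ≃ G.ι, ∀ i, F.n i = G.n (σ i) ∧ Nonempty (F.D i ≃ₐ[k] G.D (σ i)) := by
  refine ⟨?_, fun F G ⟨eF⟩ ⟨eG⟩ ↦
    Pseudocompact.DivisionFamily.exists_equiv (eF.toAlgEquiv.symm.trans eG.toAlgEquiv)⟩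
  have h21 := Pseudocompact.hasSemisimpleQuotients_of_topJacobson_eq_bot k (A := A)
  tfae_have 1 → 2 := fun h ↦ h.topJacobson_eq_bot k
  tfae_have 2 → 1 := fun h ↦ (h21 h).isTopologicallySemisimple k
  tfae_have 2 → 4 := fun h ↦ (h21 h).everyModuleProjective k
  tfae_have 2 → 5 := fun h ↦ (h21 h).everyModuleInjective k
  tfae_have 2 → 6 := fun h ↦ (h21 h).isInverseLimitOfSemisimple k
  tfae_have 4 → 1 := fun h ↦ (h.hasSemisimpleQuotients k).isTopologicallySemisimple k
  tfae_have 5 → 1 := fun h ↦ (h.hasSemisimpleQuotients k).isTopologicallySemisimple k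
  tfae_have 6 → 1 := fun h ↦ h.hasSemisimpleQuotients.isTopologicallySemisimple k
  tfae_have 2 → 7 := fun h ↦ (h21 h).exists_divisionFamily k
  tfae_have 7 → 3 := fun ⟨F, ⟨e⟩⟩ ↦ Pseudocompact.isProductOfSimples_of_divisionFamily k F e
  tfae_have 3 → 2 := fun h ↦ h.topJacobson_eq_bot k
  tfae_finish
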